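/- Let $D,R\in\{0,1\}$ be the treatment and response indicators, $X$ the covariates, $(Y(1),Y(0))$ real potential outcomes and $Y^{\rm obs}=Y(D)$, with outcomes observed only if $R=1$; so the observed data are $\mathcal O=(X,D,R,R\,Y^{\rm obs})$, with law $P$. Let $\mathcal C_0(x),\mathcal C_1(x)$ be fixed (measurable) prediction intervals for the potential outcomes, let $\mathcal C_{\rm ITE}=Y^{\rm obs}-\mathcal C_0(X)$ if $D=1$ and $\mathcal C_{\rm ITE}=\mathcal C_1(X)-Y^{\rm obs}$ if $D=0$, and let $V_{\mathcal C}=V(X,\mathcal C_{\rm ITE})$ for a fixed measurable real-valued score function $V$. Let $\gamma\in(0,1)$ and let $\eta=\eta_{\gamma,\mathcal C}$ be the $(1-\gamma)$-quantile of $V_{\mathcal C}$ given $R=0$. Assume: (i) (MAR) $(Y(1),Y(0))\perp\!\!\!\perp R\mid X,D$; (ii) (overlap) for some $c>0$, almost surely $c<\mathbb P(D=1\mid X)<1-c$ and $c<\mathbb P(R=1\mid X,D)<1-c$; (iii) $\mathbb E\big[\mathbb P(R=0\mid X,D)^2/\mathbb P(R=1\mid X,D)\big]<\infty$; (iv) the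 distribution function of $V_{\mathcal C}$ given $R=0$ is differentiable at $\eta$ with a strictly positive derivative (the density at $\eta$). For a law $Q$ of the observed data put $m_{\mathcal C,Q}(v,X,D)=Q(V_{\mathcal C}<v\mid X,D,R=1)$ and $\eta(Q)=\inf\{v:\mathbb E_Q[m_{\mathcal C,Q}(v,X,D)\mid R=0]\ge 1-\gamma\}$. Then for every law of $(X,D,R,Y(1),Y(0))$ satisfying (i) and (ii), the $(1-\gamma)$-quantile of $V_{\mathcal C}$ given $R=0$ equals $\eta(Q)$, where $Q$ is the induced law of the observed data; in particular $\eta=\eta(P)$. Moreover, with $m_{\mathcal C}=m_{\mathcal C,P}$ and $\pi_R(X,D)=\mathbb P(R=1\mid X,D)/\mathbb P(R=0\mid X,D)$, the efficient influence function of $\eta(\cdot)$ at $P$ is, up to a nonzero multiplicative constant, $$\psi_{\mathcal C}=(1-R)\big[m_{\mathcal C}(\eta,X,D)-(1-\gamma)\big]+\frac{R}{\pi_R(X,D)}\big[\mathbf 1\{V_{\mathcal C}<\eta\}-m_{\mathcal C}(\eta,X,D)\big].$$ That is, for some constant $\kappa\ne0$ the function $\psi=\kappa\,\psi_{\mathcal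 C}$ is, up to $P$-null sets, the unique square-integrable function of $\mathcal O$ with $\mathbb E_P[\psi]=0$ and $$\frac{d}{dt}\,\eta\big((1+ts)P\big)\Big|_{t=0}=\mathbb E_P[\psi(\mathcal O)s(\mathcal O)]$$ for every $s$ with $\mathbb E_P[s]=0$ and $\mathbb E_P[s^2]<\infty$, the derivative being taken along those $t$ for which $(1+ts)P$ is a probability measure (no condition if $t=0$ is the only one). No conditional independence of $D$ and $R$ given $X$ is assumed. -/

import Mathlib

open MeasureTheory ProbabilityTheory Set

noncomputable section

namespace Attrition

section Semiparametric

variable {𝒪 : Type*} [MeasurableSpace 𝒪]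

/-- The perturbation `P_t = (1 + t s) P` of a law `P` in the direction `s`. -/
def perturb (P : Measure 𝒪) (s : 𝒪 → ℝ) (t : ℝ) : Measure 𝒪 :=
  P.withDensity fun o => ENNReal.ofReal (1 + t * s o)

/-- The parameters `t` for which `(1 + t s) P` is a genuine (nonnegative) measure. If `s` has mean
zero these are the `t` for which it is a probability measure. If `s` is essentially bounded this is
a neighbourhood of `0`. -/
def validTimes (P : Measure 𝒪) (s : 𝒪 → ℝ) : Set ℝ :=
  {t | ∀ᵐ o ∂P, 0 ≤ 1 + t * s o}

/-- `ψ` is an influence function (a gradient) at `P` of the real parameter `θ` in the nonparametric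
model: it is square integrable with mean zero, and
`d/dt θ((1 + t s) P) |_{t = 0} = E_P[ψ s]` for every score `s` (square integrable, mean zero), the
derivative being taken along those `t` for which `(1 + t s) P` is a probability measure. -/
structure IsInfluenceFunction (θ : Measure 𝒪 → ℝ) (P : Measure 𝒪) (ψ : 𝒪 → ℝ) : Prop where
  memLp : MemLp ψ 2 P
  mean_zero : ∫ o, ψ o ∂P = 0
  pathwise : ∀ s : 𝒪 → ℝ, MemLp s 2 P → ∫ o, s o ∂P = 0 →
    HasDerivWithinAt (fun t => θ (perturb P s t)) (∫ o, ψ o * s o ∂P) (validTimes P s) 0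

/-- `ψ` is the efficient influence function of `θ` at `P`: the influence function, unique up to
`P`-null sets. -/
structure IsEfficientInfluenceFunction (θ : Measure 𝒪 → ℝ) (P : Measure 𝒪) (ψ : 𝒪 → ℝ) :
    Prop where
  influence : IsInfluenceFunction θ P ψ
  unique : ∀ φ : 𝒪 → ℝ, IsInfluenceFunction θ P φ → φ =ᵐ[P] ψ

end Semiparametric

/-- The `p`-quantile of a probability law on the line. -/
def quantile (ν : Measure ℝ) (p : ℝ) : ℝ := sInf {v | p ≤ cdf ν v}

section Experiment

variable {Ω 𝒳 : Type*} [MeasurableSpace Ω] [MeasurableSpace 𝒳]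

/-- `e_D(X) = P(D = 1 | X)`. -/
def treatmentProb (μ : Measure Ω) (X : Ω → 𝒳) (D : Ω → Bool) : Ω → ℝ :=
  condExp (MeasurableSpace.comap X inferInstance) μ ({ω | D ω = true}.indicator fun _ => (1 : ℝ))

/-- `P(R = r | X, D)`. For `r = 1` this is `e_R(X, D)`. -/
def responseProb (μ : Measure Ω) (X : Ω → 𝒳) (D R : Ω → Bool) (r : Bool) : Ω → ℝ :=
  condExp (MeasurableSpace.comap (fun ω => (X ω, D ω)) inferInstance) μ
    ({ω | R ω = r}.indicator fun _ => (1 : ℝ))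

/-- Missing at random: `(Y(1), Y(0))` and `R` are conditionally independent given `(X, D)`. -/
def MissingAtRandom [StandardBorelSpace Ω] (μ : Measure Ω) [IsFiniteMeasure μ]
    {X : Ω → 𝒳} {D : Ω → Bool} (hX : Measurable X) (hD : Measurable D)
    (R : Ω → Bool) (Y : Bool → Ω → ℝ) : Prop :=
  CondIndepFun (MeasurableSpace.comap (fun ω => (X ω, D ω)) inferInstance)
    (hX.prodMk hD).comap_le (fun ω => (Y true ω, Y false ω)) R μ

/-- Overlap for the treatment and for the response. -/
def Overlap (μ : Measure Ω) (X : Ω → 𝒳) (D R : Ω → Bool) : Prop :=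
  ∃ c : ℝ, 0 < c ∧ ∀ᵐ ω ∂μ,
    (c < treatmentProb μ X D ω ∧ treatmentProb μ X D ω < 1 - c) ∧
    (c < responseProb μ X D R true ω ∧ responseProb μ X D R true ω < 1 - c)

/-- The endpoints of the interval `C_ITE(x; d, y)` for the individual treatment effect built from
prediction intervals `C_d(x) = [lo d x, hi d x]` for the potential outcomes: it is `y - C_0(x)` for a
treated and `C_1(x) - y` for a control unit with outcome `y`. -/
def iteInterval (lo hi : Bool → 𝒳 → ℝ) (x : 𝒳) (d : Bool) (y : ℝ) : ℝ × ℝ :=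
  if d = true then (y - hi false x, y - lo false x) else (lo true x - y, hi true x - y)

/-- The interval nonconformity score `V_C = V(x, C_ITE(x; d, y))`. -/
def intervalScore (V : 𝒳 × (ℝ × ℝ) → ℝ) (lo hi : Bool → 𝒳 → ℝ) (x : 𝒳) (d : Bool) (y : ℝ) : ℝ :=
  V (x, iteInterval lo hi x d y)

/-- The law of `V_C = V(X, C_ITE(X; D, Y^obs))`, `Y^obs = Y(D)`, given `R = 0`, where `v x d y` is the
score as a function of covariates, treatment and outcome. -/
def attritionLaw (μ : Measure Ω) (X : Ω → 𝒳) (D R : Ω → Bool) (Y : Bool → Ω → ℝ)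
    (v : 𝒳 → Bool → ℝ → ℝ) : Measure ℝ :=
  (cond μ {ω | R ω = false}).map fun ω => v (X ω) (D ω) (Y (D ω) ω)

/-- Values of the observed data `(x, d, r, y)`; the outcome `y` is set to `0` if `r = 0`. -/
abbrev Obs (𝒳 : Type*) := 𝒳 × Bool × Bool × ℝ

/-- The observed data `(X, D, R, R Y^obs)`. -/
def observe (X : Ω → 𝒳) (D R : Ω → Bool) (Y : Bool → Ω → ℝ) (ω : Ω) : Obs 𝒳 :=
  (X ω, D ω, R ω, if R ω = true then Y (D ω) ω else 0)

end Experiment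

section ObservedData

variable {𝒳 : Type*} [MeasurableSpace 𝒳]

namespace Obs

def x (o : Obs 𝒳) : 𝒳 := o.1
def d (o : Obs 𝒳) : Bool := o.2.1
def r (o : Obs 𝒳) : Bool := o.2.2.1
def y (o : Obs 𝒳) : ℝ := o.2.2.2

end Obs

/-- `m_C(η, X, D) = E_P[1{V_C < η} | X, D, R = 1]`, as a `σ(X, D)`-measurable function of the observed
data. -/
def mC (v : 𝒳 → Bool → ℝ → ℝ) (P : Measure (Obs 𝒳)) (η : ℝ) : Obs 𝒳 → ℝ :=
  condExp (MeasurableSpace.comap (fun o : Obs 𝒳 => (Obs.x o, Obs.d o)) inferInstance)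
    (cond P {o | Obs.r o = true})
    ({o | v (Obs.x o) (Obs.d o) (Obs.y o) < η}.indicator fun _ => (1 : ℝ))

/-- The response odds `π_R(X, D) = P(R = 1 | X, D) / P(R = 0 | X, D)` under the observed law. -/
def piR (P : Measure (Obs 𝒳)) (o : Obs 𝒳) : ℝ :=
  responseProb P Obs.x Obs.d Obs.r true o / responseProb P Obs.x Obs.d Obs.r false o

/-- The parameter as a functional of the observed-data law: the smallest `η` (as an infimum) with
`E_P[m_C(η, X, D) | R = 0] ≥ p`, i.e. the solution of the moment condition
`E_P[(1 - R) (m_C(η, X, D) - p)] = 0` in the sense of the generalized inverse. -/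
def etaC (v : 𝒳 → Bool → ℝ → ℝ) (p : ℝ) (P : Measure (Obs 𝒳)) : ℝ :=
  sInf {η | p ≤ ∫ o, mC v P η o ∂(cond P {o | Obs.r o = false})}

/-- `ψ_C = (1 - R) [m_C(η, X, D) - (1 - γ)] + R / π_R(X, D) [1{V_C < η} - m_C(η, X, D)]`. -/
def psiC (v : 𝒳 → Bool → ℝ → ℝ) (P : Measure (Obs 𝒳)) (γ η : ℝ) (o : Obs 𝒳) : ℝ :=
  let r : ℝ := if Obs.r o = true then 1 else 0
  (1 - r) * (mC v P η o - (1 - γ)) +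
    r / piR P o *
      ((if v (Obs.x o) (Obs.d o) (Obs.y o) < η then 1 else 0) - mC v P η o)

end ObservedData

end Attrition

end

/-!
Writing `n_v = Q(V < v | X, D, R = 1)`, the parameter `η(Q)` is the generalized zero of the monotone
moment `v ↦ E_Q[(1 - R) (n_v - p)]`, where `p = 1 - γ`.

Weighting by the conditional odds `1 / π_R` carries averages of `σ(X, D)`-measurable variables from
`R = 1` to `R = 0`; under missingness at random it also carries averages of functions of the
potential outcomes, so the moment identifies the law of `V` given `R = 0`.

The moment function plus the odds-weighted residual of `1{V < v}` is a gradient `ψ_v` orthogonal to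
errors in the nuisance `n_v`. Along `(1 + t s) P` the moment is therefore its value at `P` plus
`t E_P[ψ_v s]`, up to a product of `t` with the error of `n_v`. The normal equation of the
regression bounds the squared `L²` norm of that error by a multiple of `|t|` times its pairing with
`|s|`, so by Cauchy-Schwarz the pairing is `O(t)` and the remainder is `O(t²)` uniformly in `v`.

Inverting a monotone function with such an expansion needs only continuity of `v ↦ E_P[ψ_v s]` at
`η`, which holds because increments of the moment control `‖ψ_v - ψ_u‖²`. This gives the derivative
`-E_P[ψ_η s] / b`, with `b` the slope of the moment at `η`. Uniqueness only needs the bounded scores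
`1_S - P(S)`.
-/

noncomputable section

namespace Attrition

open scoped ENNReal

section ConditionalProbability

variable {𝒪 : Type*}

/-- The real-valued indicator of an event, as a random variable to be averaged or multiplied. -/
abbrev ind (A : Set 𝒪) : 𝒪 → ℝ := A.indicator fun _ => 1

lemma ind_nonneg (A : Set 𝒪) (o : 𝒪) : 0 ≤ ind A o :=
  indicator_nonneg (fun _ _ => zero_le_one) o

lemma ind_le_one (A : Set 𝒪) (o : 𝒪) : ind A o ≤ 1 :=
  indicator_le' (fun _ _ => le_rfl) (fun _ _ => zero_le_one) o

lemma ind_mul_eq_indicator (A : Set 𝒪) (f : 𝒪 → ℝ) :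
    (fun o => ind A o * f o) = A.indicator f := by
  ext o
  by_cases h : o ∈ A <;> simp [h]

variable {m mO : MeasurableSpace 𝒪} {P Q : Measure 𝒪} {A S S' : Set 𝒪} {c : ℝ}

lemma memLp_ind [IsFiniteMeasure P] (p : ℝ≥0∞) (hA : MeasurableSet A) : MemLp (ind A) p P :=
  memLp_indicator_const p hA 1 (Or.inr (measure_ne_top P A))

lemma integrable_of_memLp_top [IsFiniteMeasure Q] {f : 𝒪 → ℝ} (hf : MemLp f ∞ P) (hQP : Q ≪ P) :
    Integrable f Q := by
  have hf' : MemLp f ∞ Q := by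
    refine ⟨hf.1.mono_ac hQP, lt_of_le_of_lt ?_ hf.2⟩
    simpa only [eLpNorm_exponent_top] using eLpNormEssSup_mono_measure f hQP
  exact hf'.integrable le_top

lemma integrable_ind [IsFiniteMeasure P] (hA : MeasurableSet A) : Integrable (ind A) P :=
  (integrable_const 1).indicator hA

lemma integral_ind (hA : MeasurableSet A) : ∫ o, ind A o ∂P = P.real A :=
  integral_indicator_one hA

lemma integrable_ind_mul (hA : MeasurableSet A) {f : 𝒪 → ℝ} (hf : Integrable f P) :
    Integrable (fun o => ind A o * f o) P :=
  ind_mul_eq_indicator A f ▸ hf.indicator hA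

lemma integrable_cond [IsFiniteMeasure Q] {f : 𝒪 → ℝ} (hf : Integrable f Q) (A : Set 𝒪) :
    Integrable f (cond Q A) := by
  by_cases hQA : Q A = 0
  · simp [cond_eq_zero_of_meas_eq_zero hQA]
  · exact hf.restrict.smul_measure (ENNReal.inv_ne_top.2 hQA)

lemma integral_ind_mul (hA : MeasurableSet A) [IsFiniteMeasure Q] (f : 𝒪 → ℝ) :
    ∫ o, ind A o * f o ∂Q = Q.real A * ∫ o, f o ∂(cond Q A) := by
  rw [ind_mul_eq_indicator, integral_indicator hA]
  by_cases hQA : Q A = 0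
  · simp [Measure.restrict_eq_zero.2 hQA, measureReal_def, hQA]
  · have hQA' : Q.real A ≠ 0 := (measureReal_ne_zero_iff).2 hQA
    rw [ProbabilityTheory.cond, integral_smul_measure, ENNReal.toReal_inv, smul_eq_mul,
      ← measureReal_def, mul_inv_cancel_left₀ hQA']

lemma integral_mul_condExp (hm : m ≤ mO) [IsFiniteMeasure Q] {h k : 𝒪 → ℝ}
    (hh : StronglyMeasurable[m] h) (hhk : Integrable (fun o => h o * k o) Q)
    (hk : Integrable k Q) :
    ∫ o, h o * k o ∂Q = ∫ o, h o * (condExp m Q k) o ∂Q := by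
  rw [← integral_condExp hm]
  exact integral_congr_ae (condExp_mul_of_stronglyMeasurable_left hh hhk hk)

lemma integrable_mul_condExp [IsFiniteMeasure Q] {h k : 𝒪 → ℝ}
    (hh : StronglyMeasurable[m] h) (hhk : Integrable (fun o => h o * k o) Q)
    (hk : Integrable k Q) : Integrable (fun o => h o * (condExp m Q k) o) Q :=
  integrable_condExp.congr (condExp_mul_of_stronglyMeasurable_left hh hhk hk)

lemma condExp_ind_mem_Icc (hm : m ≤ mO) [IsFiniteMeasure Q] (hS : MeasurableSet S) :
    ∀ᵐ o ∂Q, condExp m Q (ind S) o ∈ Icc 0 1 := by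
  have h_le := condExp_mono (m := m) (integrable_ind hS) (integrable_const (μ := Q) 1)
    (.of_forall (ind_le_one S))
  rw [condExp_const hm] at h_le
  filter_upwards [condExp_nonneg (m := m) (.of_forall (ind_nonneg S)), h_le] with o h0 h1
  exact ⟨h0, h1⟩

/-- The conditional probability of `A` given `m` is at least `c > 0`: the positivity assumption
under which conditioning on `A` loses no `m`-measurable information. -/
structure UniformPositivity (m : MeasurableSpace 𝒪) {_ : MeasurableSpace 𝒪} (P : Measure 𝒪)
    (A : Set 𝒪) (c : ℝ) : Prop where
  pos : 0 < c
  le_condExp : ∀ᵐ o ∂P, c ≤ condExp m P (ind A) o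

namespace UniformPositivity

variable [IsFiniteMeasure P]

lemma mul_integral_le (H : UniformPositivity m P A c) (hm : m ≤ mO) (hA : MeasurableSet A)
    {h : 𝒪 → ℝ} (hh : StronglyMeasurable[m] h) (hint : Integrable h P) (h0 : 0 ≤ᵐ[P] h) :
    c * ∫ o, h o ∂P ≤ ∫ o, ind A o * h o ∂P := by
  simp_rw [mul_comm (ind A _)]
  have hhA : Integrable (fun o => h o * ind A o) P := by
    simpa only [mul_comm] using integrable_ind_mul hA hint
  rw [integral_mul_condExp hm hh hhA (integrable_ind hA), ← integral_const_mul]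
  refine integral_mono_ae (hint.const_mul c)
    (integrable_mul_condExp hh hhA (integrable_ind hA)) ?_
  filter_upwards [H.le_condExp, h0] with o hc h0
  exact (mul_comm c _).trans_le (mul_le_mul_of_nonneg_left hc h0)

lemma ae_of_ae_cond (H : UniformPositivity m P A c) (hm : m ≤ mO) (hA : MeasurableSet A)
    [IsFiniteMeasure Q] (hPQ : P ≪ Q) {B : Set 𝒪} (hB : MeasurableSet[m] B)
    (h : ∀ᵐ o ∂(cond Q A), o ∈ B) : ∀ᵐ o ∂P, o ∈ B := by
  have h_restrict : ∀ᵐ o ∂(P.restrict A), o ∈ B :=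
    ((hPQ.restrict A).trans (Measure.absolutelyContinuous_smul
      (ENNReal.inv_ne_zero.2 (measure_ne_top Q A)))).ae_le h
  have h_zero : ∫ o, ind A o * ind Bᶜ o ∂P = 0 := by
    rw [ind_mul_eq_indicator, integral_indicator hA]
    refine integral_eq_zero_of_ae ?_
    filter_upwards [h_restrict] with o ho
    simp [ho]
  have h_le := H.mul_integral_le hm hA
    ((stronglyMeasurable_const (b := (1 : ℝ))).indicator hB.compl)
    (integrable_ind (hm _ hB.compl)) (.of_forall (ind_nonneg _))
  rw [h_zero, integral_ind (hm _ hB.compl)] at h_le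
  exact (measureReal_eq_zero_iff).1
    (le_antisymm (nonpos_of_mul_nonpos_right h_le H.pos) measureReal_nonneg)

end UniformPositivity

/-- `Q(S | m, A)`, the conditional probability of `S` given `m` under the law conditioned on `A`. -/
def condProbOn (m : MeasurableSpace 𝒪) {_ : MeasurableSpace 𝒪} (Q : Measure 𝒪) (A S : Set 𝒪) :
    𝒪 → ℝ :=
  condExp m (cond Q A) (ind S)

lemma stronglyMeasurable_condProbOn : StronglyMeasurable[m] (condProbOn m Q A S) :=
  stronglyMeasurable_condExp

lemma integral_residual_eq_zero (hm : m ≤ mO) (hA : MeasurableSet A) (hS : MeasurableSet S)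
    [IsFiniteMeasure Q] {h : 𝒪 → ℝ} (hh : StronglyMeasurable[m] h) (hint : Integrable h Q) :
    ∫ o, ind A o * (h o * (ind S o - condProbOn m Q A S o)) ∂Q = 0 := by
  have hhS : Integrable (fun o => h o * ind S o) (cond Q A) := by
    simpa only [mul_comm] using integrable_ind_mul hS (integrable_cond hint A)
  have hS_int : Integrable (ind S) (cond Q A) := integrable_ind hS
  rw [integral_ind_mul hA]
  simp_rw [condProbOn, mul_sub]
  rw [integral_sub hhS (integrable_mul_condExp hh hhS hS_int),
    integral_mul_condExp hm hh hhS hS_int, sub_self, mul_zero]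

section Positivity

variable [IsFiniteMeasure P] [IsFiniteMeasure Q]

lemma condProbOn_mem_Icc (hm : m ≤ mO) (H : UniformPositivity m P A c) (hA : MeasurableSet A)
    (hS : MeasurableSet S) (hPQ : P ≪ Q) : ∀ᵐ o ∂P, condProbOn m Q A S o ∈ Icc 0 1 :=
  H.ae_of_ae_cond hm hA hPQ
    (stronglyMeasurable_condProbOn.measurable measurableSet_Icc) (condExp_ind_mem_Icc hm hS)

lemma condProbOn_mono (hm : m ≤ mO) (H : UniformPositivity m P A c) (hA : MeasurableSet A)
    (hS : MeasurableSet S) (hS' : MeasurableSet S') (hSS' : S ⊆ S') (hPQ : P ≪ Q) :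
    condProbOn m Q A S ≤ᵐ[P] condProbOn m Q A S' :=
  H.ae_of_ae_cond hm hA hPQ
    (stronglyMeasurable_condProbOn.measurableSet_le stronglyMeasurable_condProbOn)
    (condExp_mono (integrable_ind hS) (integrable_ind hS')
      (.of_forall (indicator_le_indicator_of_subset hSS' fun _ => zero_le_one)))

lemma memLp_top_condProbOn (hm : m ≤ mO) (H : UniformPositivity m P A c) (hA : MeasurableSet A)
    (hS : MeasurableSet S) (hPQ : P ≪ Q) : MemLp (condProbOn m Q A S) ∞ P := by
  refine memLp_top_of_bound (stronglyMeasurable_condProbOn.mono hm).aestronglyMeasurable 1 ?_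
  filter_upwards [condProbOn_mem_Icc hm H hA hS hPQ] with o ho
  exact (abs_of_nonneg ho.1).trans_le ho.2

lemma memLp_top_residual (hm : m ≤ mO) (H : UniformPositivity m P A c) (hA : MeasurableSet A)
    (hS : MeasurableSet S) (hPQ : P ≪ Q) {h : 𝒪 → ℝ} (hh : MemLp h ∞ P) :
    MemLp (fun o => ind A o * (h o * (ind S o - condProbOn m Q A S o))) ∞ P :=
  (MemLp.mul' (r := ∞) ((memLp_ind ∞ hS).sub (memLp_top_condProbOn hm H hA hS hPQ)) hh).mul'
    (memLp_ind ∞ hA)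

end Positivity

/-- The conditional odds of `Aᶜ` given `m`, the weight that transports averages of
`m`-measurable variables from `A` to `Aᶜ`. -/
def condOdds (m : MeasurableSpace 𝒪) {_ : MeasurableSpace 𝒪} (P : Measure 𝒪) (A : Set 𝒪)
    (o : 𝒪) : ℝ :=
  condExp m P (ind Aᶜ) o / condExp m P (ind A) o

lemma stronglyMeasurable_condOdds : StronglyMeasurable[m] (condOdds m P A) :=
  stronglyMeasurable_condExp.div stronglyMeasurable_condExp

variable [IsFiniteMeasure P]

lemma condOdds_mem_Icc (hm : m ≤ mO) (H : UniformPositivity m P A c) (hA : MeasurableSet A) :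
    ∀ᵐ o ∂P, condOdds m P A o ∈ Icc 0 (1 / c) := by
  filter_upwards [H.le_condExp, condExp_ind_mem_Icc hm hA.compl] with o hc hcompl
  exact ⟨div_nonneg hcompl.1 (H.pos.le.trans hc), div_le_div₀ zero_le_one hcompl.2 H.pos hc⟩

lemma memLp_top_condOdds (hm : m ≤ mO) (H : UniformPositivity m P A c) (hA : MeasurableSet A) :
    MemLp (condOdds m P A) ∞ P := by
  refine memLp_top_of_bound (stronglyMeasurable_condOdds.mono hm).aestronglyMeasurable (1 / c) ?_
  filter_upwards [condOdds_mem_Icc hm H hA] with o ho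
  exact (abs_of_nonneg ho.1).trans_le ho.2

lemma integral_ind_compl_mul (hm : m ≤ mO) (H : UniformPositivity m P A c)
    (hA : MeasurableSet A) {h : 𝒪 → ℝ} (hh : StronglyMeasurable[m] h) (hint : Integrable h P) :
    ∫ o, ind Aᶜ o * h o ∂P = ∫ o, ind A o * (condOdds m P A o * h o) ∂P := by
  have hρh : Integrable (fun o => condOdds m P A o * h o) P :=
    hint.mul_of_top_right (memLp_top_condOdds hm H hA)
  have h_left := integrable_ind_mul hA.compl hint
  have h_right := integrable_ind_mul hA hρh
  simp_rw [mul_comm (ind _ _)] at h_left h_right ⊢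
  rw [integral_mul_condExp hm hh h_left (integrable_ind hA.compl),
    integral_mul_condExp (h := fun o => condOdds m P A o * h o) hm
      (stronglyMeasurable_condOdds.mul hh) h_right (integrable_ind hA)]
  refine integral_congr_ae ?_
  filter_upwards [H.le_condExp] with o hc
  have h_ne : condExp m P (ind A) o ≠ 0 := (H.pos.trans_le hc).ne'
  simp only [condOdds]
  field_simp

end ConditionalProbability

section Perturbation

open Filter Topology

variable {𝒪 : Type*} [MeasurableSpace 𝒪] {P : Measure 𝒪} {s : 𝒪 → ℝ} {t : ℝ}

lemma perturb_zero (P : Measure 𝒪) (s : 𝒪 → ℝ) : perturb P s 0 = P := by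
  simp [perturb]

lemma perturb_absolutelyContinuous : perturb P s t ≪ P :=
  withDensity_absolutelyContinuous _ _

lemma absolutelyContinuous_perturb (hs : AEMeasurable s P) (ht : ∀ᵐ o ∂P, 0 < 1 + t * s o) :
    P ≪ perturb P s t :=
  withDensity_absolutelyContinuous' ((hs.const_mul t).const_add 1).ennreal_ofReal
    (ht.mono fun _ ho => (ENNReal.ofReal_pos.2 ho).ne')

lemma isFiniteMeasure_perturb [IsFiniteMeasure P] (hs : Integrable s P) (t : ℝ) :
    IsFiniteMeasure (perturb P s t) :=
  isFiniteMeasure_withDensity_ofReal ((integrable_const 1).add (hs.const_mul t)).2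

lemma integral_perturb (hs : AEMeasurable s P) (ht : ∀ᵐ o ∂P, 0 ≤ 1 + t * s o) (f : 𝒪 → ℝ) :
    ∫ o, f o ∂(perturb P s t) = ∫ o, (1 + t * s o) * f o ∂P := by
  rw [perturb, integral_withDensity_eq_integral_toReal_smul₀
    ((hs.const_mul t).const_add 1).ennreal_ofReal (.of_forall fun _ => ENNReal.ofReal_lt_top)]
  refine integral_congr_ae (ht.mono fun o ho => ?_)
  simp only [ENNReal.toReal_ofReal ho, smul_eq_mul]

lemma integral_perturb_eq_add (hs : AEMeasurable s P) (ht : ∀ᵐ o ∂P, 0 ≤ 1 + t * s o) {f : 𝒪 → ℝ}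
    (hf : Integrable f P) (hsf : Integrable (fun o => s o * f o) P) :
    ∫ o, f o ∂(perturb P s t) = ∫ o, f o ∂P + t * ∫ o, s o * f o ∂P := by
  rw [integral_perturb hs ht, ← integral_const_mul, ← integral_add hf (hsf.const_mul t)]
  exact integral_congr_ae (.of_forall fun o => by ring)

lemma validTimes_ordConnected (P : Measure 𝒪) (s : 𝒪 → ℝ) : (validTimes P s).OrdConnected := by
  refine ⟨fun a ha b hb t ht => ?_⟩
  change ∀ᵐ o ∂P, 0 ≤ 1 + t * s o
  filter_upwards [ha, hb] with o hoa hob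
  rcases le_total 0 (s o) with hs | hs
  · nlinarith [mul_le_mul_of_nonneg_right ht.1 hs]
  · nlinarith [mul_le_mul_of_nonpos_right ht.2 hs]

lemma zero_mem_validTimes (P : Measure 𝒪) (s : 𝒪 → ℝ) : 0 ∈ validTimes P s :=
  ae_of_all P fun o => show 0 ≤ 1 + 0 * s o by simp

lemma eventually_two_mul_mem {T : Set ℝ} (hT : T.OrdConnected) (h0 : 0 ∈ T) :
    ∀ᶠ t in 𝓝[T] 0, 2 * t ∈ T := by
  have h_far : ∀ a ∈ T, a ≠ 0 → ∀ᶠ t : ℝ in 𝓝[T] 0, 2 * |t| < |a| := fun a _ ha =>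
    nhdsWithin_le_nhds ((by fun_prop : Continuous fun t : ℝ => 2 * |t|).continuousAt.eventually_lt
      continuousAt_const (by simpa using ha))
  have h_pos : ∀ᶠ t in 𝓝[T] 0, 0 < t → 2 * t ∈ T := by
    by_cases h : ∃ a ∈ T, 0 < a
    · obtain ⟨a, ha, ha0⟩ := h
      filter_upwards [h_far a ha ha0.ne'] with t hta ht
      rw [abs_of_pos ht, abs_of_pos ha0] at hta
      exact hT.out h0 ha ⟨by linarith, hta.le⟩
    · filter_upwards [self_mem_nhdsWithin] with t ht ht0
      exact absurd ⟨t, ht, ht0⟩ h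
  have h_neg : ∀ᶠ t in 𝓝[T] 0, t < 0 → 2 * t ∈ T := by
    by_cases h : ∃ a ∈ T, a < 0
    · obtain ⟨a, ha, ha0⟩ := h
      filter_upwards [h_far a ha ha0.ne] with t hta ht
      rw [abs_of_neg ht, abs_of_neg ha0] at hta
      exact hT.out ha h0 ⟨by linarith, by linarith⟩
    · filter_upwards [self_mem_nhdsWithin] with t ht ht0
      exact absurd ⟨t, ht, ht0⟩ h
  filter_upwards [h_pos, h_neg] with t hp hn
  rcases lt_trichotomy t 0 with h | rfl | h
  exacts [hn h, by simpa using h0, hp h]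

lemma eventually_half_le_perturb_density (P : Measure 𝒪) (s : 𝒪 → ℝ) :
    ∀ᶠ t in 𝓝[validTimes P s] 0, ∀ᵐ o ∂P, 1 / 2 ≤ 1 + t * s o := by
  filter_upwards [eventually_two_mul_mem (validTimes_ordConnected P s) (zero_mem_validTimes P s)]
    with t ht
  filter_upwards [ht] with o ho
  linarith

lemma validTimes_mem_nhds_zero {C : ℝ} (hC : ∀ᵐ o ∂P, |s o| ≤ C) : validTimes P s ∈ 𝓝 0 := by
  have h_small : ∀ᶠ t : ℝ in 𝓝 0, |t| * C < 1 :=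
    (by fun_prop : Continuous fun t : ℝ => |t| * C).continuousAt.eventually_lt
      continuousAt_const (by simp)
  filter_upwards [h_small] with t ht
  filter_upwards [hC] with o ho
  have h_abs : |t * s o| ≤ |t| * C := (abs_mul _ _).trans_le (by gcongr)
  linarith [neg_abs_le (t * s o)]

lemma integral_mul_ind_sub_const {k : 𝒪 → ℝ} {S : Set 𝒪} (hS : MeasurableSet S)
    (hk : Integrable k P) (hk0 : ∫ o, k o ∂P = 0) (a : ℝ) :
    ∫ o, k o * (ind S o - a) ∂P = ∫ o in S, k o ∂P := by
  simp_rw [mul_sub, mul_comm (k _)]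
  rw [integral_sub (integrable_ind_mul hS hk) (hk.const_mul a), integral_const_mul, hk0, mul_zero,
    sub_zero, ind_mul_eq_indicator, integral_indicator hS]

theorem IsInfluenceFunction.ae_eq [IsProbabilityMeasure P] {θ : Measure 𝒪 → ℝ} {φ ψ : 𝒪 → ℝ}
    (hφ : IsInfluenceFunction θ P φ) (hψ : IsInfluenceFunction θ P ψ) : φ =ᵐ[P] ψ := by
  have hφ_int : Integrable φ P := hφ.memLp.integrable one_le_two
  have hψ_int : Integrable ψ P := hψ.memLp.integrable one_le_two
  refine Integrable.ae_eq_of_forall_setIntegral_eq φ ψ hφ_int hψ_int fun S hS _ => ?_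
  let s : 𝒪 → ℝ := fun o => ind S o - P.real S
  have hs : MemLp s 2 P := (memLp_ind 2 hS).sub (memLp_const _)
  have hs_mean : ∫ o, s o ∂P = 0 := by
    rw [integral_sub (integrable_ind hS) (integrable_const _), integral_ind hS]
    simp
  have hs_bound : ∀ o, |s o| ≤ 1 := fun o => abs_le.2
    ⟨by linarith [ind_nonneg S o, measureReal_le_one (μ := P) (s := S)],
      by linarith [ind_le_one S o, measureReal_nonneg (μ := P) (s := S)]⟩
  have h_nhds := validTimes_mem_nhds_zero (P := P) (.of_forall hs_bound)
  rw [← integral_mul_ind_sub_const hS hφ_int hφ.mean_zero (P.real S),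
    ← integral_mul_ind_sub_const hS hψ_int hψ.mean_zero (P.real S)]
  exact ((hφ.pathwise s hs hs_mean).hasDerivAt h_nhds).unique
    ((hψ.pathwise s hs hs_mean).hasDerivAt h_nhds)

end Perturbation

section Expansion

variable {𝒪 : Type*} {m mO : MeasurableSpace 𝒪} {P Q : Measure 𝒪} {A S S' : Set 𝒪}
  {c p t : ℝ} {s : 𝒪 → ℝ}

lemma inner_toLp {f k : 𝒪 → ℝ} (hf : MemLp f 2 P) (hk : MemLp k 2 P) :
    inner ℝ (hf.toLp f) (hk.toLp k) = ∫ o, f o * k o ∂P := by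
  rw [L2.inner_def]
  refine integral_congr_ae ?_
  filter_upwards [hf.coeFn_toLp, hk.coeFn_toLp] with o hf hk
  rw [hf, hk, RCLike.inner_apply', conj_trivial]

lemma sq_integral_mul_le {f k : 𝒪 → ℝ} (hf : MemLp f 2 P) (hk : MemLp k 2 P) :
    (∫ o, f o * k o ∂P) ^ 2 ≤ (∫ o, f o ^ 2 ∂P) * ∫ o, k o ^ 2 ∂P := by
  simpa only [inner_toLp, ← sq] using real_inner_mul_inner_self_le (hf.toLp f) (hk.toLp k)

/-- The moment `E_Q[1_{Aᶜ} (Q(S | m, A) - p)]`, whose sign decides whether the mass which `S`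
is predicted to have on the unobserved event `Aᶜ` reaches the level `p`. -/
def attritionMoment (m : MeasurableSpace 𝒪) {_ : MeasurableSpace 𝒪} (Q : Measure 𝒪)
    (A S : Set 𝒪) (p : ℝ) : ℝ :=
  ∫ o, ind Aᶜ o * (condProbOn m Q A S o - p) ∂Q

/-- The gradient of `attritionMoment` at `P`: the moment function itself plus the odds-weighted
residual of the regression of `1_S` on `m` within `A`. -/
def momentGradient (m : MeasurableSpace 𝒪) {_ : MeasurableSpace 𝒪} (P : Measure 𝒪)
    (A S : Set 𝒪) (p : ℝ) (o : 𝒪) : ℝ :=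
  ind Aᶜ o * (condProbOn m P A S o - p) +
    ind A o * (condOdds m P A o * (ind S o - condProbOn m P A S o))

/-- The difference between the weight `1_{Aᶜ}` and the odds weight on `A`; it averages every
`m`-measurable variable to zero. -/
def oddsContrast (m : MeasurableSpace 𝒪) {_ : MeasurableSpace 𝒪} (P : Measure 𝒪) (A : Set 𝒪)
    (o : 𝒪) : ℝ :=
  ind Aᶜ o - ind A o * condOdds m P A o

/-- The change of the conditional probability `P(S | m, A)` under the perturbation `(1 + t s) P`. -/
def condProbShift (m : MeasurableSpace 𝒪) {_ : MeasurableSpace 𝒪} (P : Measure 𝒪) (A S : Set 𝒪)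
    (s : 𝒪 → ℝ) (t : ℝ) (o : 𝒪) : ℝ :=
  condProbOn m (perturb P s t) A S o - condProbOn m P A S o

variable [IsFiniteMeasure P]

lemma memLp_top_oddsContrast (hm : m ≤ mO) (H : UniformPositivity m P A c)
    (hA : MeasurableSet A) : MemLp (oddsContrast m P A) ∞ P :=
  (memLp_ind ∞ hA.compl).sub ((memLp_top_condOdds hm H hA).mul' (memLp_ind ∞ hA))

lemma abs_oddsContrast_le (hm : m ≤ mO) (H : UniformPositivity m P A c) (hA : MeasurableSet A) :
    ∀ᵐ o ∂P, |oddsContrast m P A o| ≤ 1 + 1 / c := by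
  filter_upwards [condOdds_mem_Icc hm H hA] with o ⟨hρ0, hρ1⟩
  by_cases ho : o ∈ A
  · simp only [oddsContrast, ind, mem_compl_iff, ho, not_true_eq_false, not_false_eq_true,
      indicator_of_notMem, indicator_of_mem, one_mul, zero_sub, abs_neg, abs_of_nonneg hρ0]
    linarith
  · simp only [oddsContrast, ind, mem_compl_iff, ho, not_false_eq_true, indicator_of_notMem,
      indicator_of_mem, zero_mul, sub_zero, abs_one]
    linarith [hρ0.trans hρ1]

lemma integral_oddsContrast_mul (hm : m ≤ mO) (H : UniformPositivity m P A c)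
    (hA : MeasurableSet A) {h : 𝒪 → ℝ} (hh : StronglyMeasurable[m] h) (hint : Integrable h P) :
    ∫ o, oddsContrast m P A o * h o ∂P = 0 := by
  have hρh : Integrable (fun o => condOdds m P A o * h o) P :=
    hint.mul_of_top_right (memLp_top_condOdds hm H hA)
  simp_rw [oddsContrast, sub_mul, mul_assoc]
  rw [integral_sub (integrable_ind_mul hA.compl hint) (integrable_ind_mul hA hρh),
    integral_ind_compl_mul hm H hA hh hint, sub_self]

lemma memLp_top_momentGradient (hm : m ≤ mO) (H : UniformPositivity m P A c)
    (hA : MeasurableSet A) (hS : MeasurableSet S) : MemLp (momentGradient m P A S p) ∞ P :=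
  (((memLp_top_condProbOn hm H hA hS .rfl).sub (memLp_const p)).mul' (memLp_ind ∞ hA.compl)).add
    (memLp_top_residual hm H hA hS .rfl (memLp_top_condOdds hm H hA))

lemma attritionMoment_sub_integral_momentGradient [IsFiniteMeasure Q] (hm : m ≤ mO)
    (H : UniformPositivity m P A c) (hA : MeasurableSet A) (hS : MeasurableSet S)
    (hPQ : P ≪ Q) (hQP : Q ≪ P) :
    attritionMoment m Q A S p - ∫ o, momentGradient m P A S p o ∂Q =
      ∫ o, oddsContrast m P A o * (condProbOn m Q A S o - condProbOn m P A S o) ∂Q := by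
  have hn := memLp_top_condProbOn hm H hA hS .rfl
  have hn' := memLp_top_condProbOn hm H hA hS hPQ
  have hρ := memLp_top_condOdds hm H hA
  have h_moment : Integrable (fun o => ind Aᶜ o * (condProbOn m Q A S o - p)) Q :=
    integrable_ind_mul hA.compl (integrable_of_memLp_top (hn'.sub (memLp_const p)) hQP)
  have h_gradient := integrable_of_memLp_top
    (memLp_top_momentGradient (p := p) hm H hA hS) hQP
  have h_contrast : Integrable (fun o => oddsContrast m P A o *
      (condProbOn m Q A S o - condProbOn m P A S o)) Q :=
    integrable_of_memLp_top ((hn'.sub hn).mul' (memLp_top_oddsContrast hm H hA)) hQP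
  have h_residual := integrable_of_memLp_top (memLp_top_residual hm H hA hS hPQ hρ) hQP
  calc attritionMoment m Q A S p - ∫ o, momentGradient m P A S p o ∂Q
      = ∫ o, (oddsContrast m P A o * (condProbOn m Q A S o - condProbOn m P A S o) -
          ind A o * (condOdds m P A o * (ind S o - condProbOn m Q A S o))) ∂Q := by
        rw [attritionMoment, ← integral_sub h_moment h_gradient]
        refine integral_congr_ae (.of_forall fun o => ?_)
        simp only [momentGradient, oddsContrast]
        ring
    _ = _ := by
        rw [integral_sub h_contrast h_residual, integral_residual_eq_zero hm hA hS
          stronglyMeasurable_condOdds (integrable_of_memLp_top hρ hQP), sub_zero]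

lemma integral_momentGradient (hm : m ≤ mO) (H : UniformPositivity m P A c)
    (hA : MeasurableSet A) (hS : MeasurableSet S) :
    ∫ o, momentGradient m P A S p o ∂P = attritionMoment m P A S p := by
  have h := attritionMoment_sub_integral_momentGradient (p := p) hm H hA hS .rfl .rfl
  simp only [sub_self, mul_zero, integral_zero] at h
  exact (sub_eq_zero.1 h).symm

lemma integral_ind_mul_sub_sq [IsFiniteMeasure Q] (hm : m ≤ mO) (H : UniformPositivity m P A c)
    (hA : MeasurableSet A) (hS : MeasurableSet S) (hPQ : P ≪ Q) (hQP : Q ≪ P) :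
    ∫ o, ind A o * (condProbOn m Q A S o - condProbOn m P A S o) ^ 2 ∂Q =
      ∫ o, ind A o * ((condProbOn m Q A S o - condProbOn m P A S o) *
        (ind S o - condProbOn m P A S o)) ∂Q := by
  have hδ := (memLp_top_condProbOn hm H hA hS hPQ).sub (memLp_top_condProbOn hm H hA hS .rfl)
  have h_zero := integral_residual_eq_zero (S := S) hm hA hS
    (stronglyMeasurable_condProbOn.sub stronglyMeasurable_condProbOn)
    (integrable_of_memLp_top hδ hQP)
  rw [eq_comm, ← sub_zero (∫ o, ind A o * (_ * _) ∂Q), ← h_zero, ← integral_sub]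
  · exact integral_congr_ae (.of_forall fun o => by simp only [Pi.sub_apply]; ring)
  · exact integrable_of_memLp_top (memLp_top_residual hm H hA hS .rfl hδ) hQP
  · exact integrable_of_memLp_top (memLp_top_residual hm H hA hS hPQ hδ) hQP

omit [IsFiniteMeasure P] in
lemma stronglyMeasurable_condProbShift : StronglyMeasurable[m] (condProbShift m P A S s t) :=
  stronglyMeasurable_condProbOn.sub stronglyMeasurable_condProbOn

omit [IsFiniteMeasure P] in
lemma abs_integral_mul_le {f k : 𝒪 → ℝ} {C : ℝ} (hfk : Integrable (fun o => |f o| * |k o|) P)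
    {h : 𝒪 → ℝ} (hh : ∀ᵐ o ∂P, |h o| ≤ C * |k o|) :
    |∫ o, f o * h o ∂P| ≤ C * ∫ o, |f o| * |k o| ∂P := by
  rw [← integral_const_mul, ← Real.norm_eq_abs]
  refine norm_integral_le_of_norm_le (hfk.const_mul C) ?_
  filter_upwards [hh] with o ho
  rw [Real.norm_eq_abs, abs_mul, mul_left_comm]
  exact mul_le_mul_of_nonneg_left ho (abs_nonneg _)

section Shift

variable (hm : m ≤ mO) (H : UniformPositivity m P A c) (hA : MeasurableSet A)
  (hS : MeasurableSet S)

include hm H hA hS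

lemma abs_ind_mul_residual_le (h : 𝒪 → ℝ) :
    ∀ᵐ o ∂P, |ind A o * (h o * (ind S o - condProbOn m P A S o))| ≤ |h o| := by
  filter_upwards [condProbOn_mem_Icc hm H hA hS .rfl] with o ⟨hn0, hn1⟩
  have h_residual : |ind S o - condProbOn m P A S o| ≤ 1 := abs_le.2
    ⟨by linarith [ind_nonneg S o], by linarith [ind_le_one S o]⟩
  rw [abs_mul, abs_mul, abs_of_nonneg (ind_nonneg A o)]
  exact (mul_le_of_le_one_left (by positivity) (ind_le_one A o)).trans
    (mul_le_of_le_one_right (abs_nonneg _) h_residual)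

lemma memLp_top_condProbShift (hs : Integrable s P) (ht : ∀ᵐ o ∂P, 0 < 1 + t * s o) :
    MemLp (condProbShift m P A S s t) ∞ P :=
  have := isFiniteMeasure_perturb hs t
  (memLp_top_condProbOn hm H hA hS (absolutelyContinuous_perturb hs.aemeasurable ht)).sub
    (memLp_top_condProbOn hm H hA hS .rfl)

lemma integral_ind_mul_condProbShift_sq (hs : Integrable s P)
    (ht : ∀ᵐ o ∂P, 0 < 1 + t * s o) :
    ∫ o, (1 + t * s o) * (ind A o * condProbShift m P A S s t o ^ 2) ∂P =
      t * ∫ o, s o * (ind A o * (condProbShift m P A S s t o *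
        (ind S o - condProbOn m P A S o))) ∂P := by
  have := isFiniteMeasure_perturb hs t
  have ht0 : ∀ᵐ o ∂P, 0 ≤ 1 + t * s o := ht.mono fun _ => le_of_lt
  have hδ := memLp_top_condProbShift hm H hA hS hs ht
  have hδ_residual := memLp_top_residual hm H hA hS .rfl hδ
  rw [← integral_perturb hs.aemeasurable ht0, ← zero_add (t * _),
    ← integral_residual_eq_zero hm hA hS stronglyMeasurable_condProbShift (hδ.integrable le_top)]
  exact (integral_ind_mul_sub_sq hm H hA hS (absolutelyContinuous_perturb hs.aemeasurable ht)
    perturb_absolutelyContinuous).trans (integral_perturb_eq_add hs.aemeasurable ht0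
      (hδ_residual.integrable le_top) (hs.mul_of_top_left hδ_residual))

lemma mul_integral_condProbShift_sq_le (hs : Integrable s P)
    (ht : ∀ᵐ o ∂P, 1 / 2 ≤ 1 + t * s o) :
    c * ∫ o, condProbShift m P A S s t o ^ 2 ∂P ≤
      2 * |t| * ∫ o, |s o| * |condProbShift m P A S s t o| ∂P := by
  have ht0 : ∀ᵐ o ∂P, 0 < 1 + t * s o := ht.mono fun _ => one_half_pos.trans_le
  have hδ := memLp_top_condProbShift hm H hA hS hs ht0
  have hδ_sq : MemLp (fun o => condProbShift m P A S s t o ^ 2) ∞ P := by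
    simpa only [sq] using hδ.mul' hδ
  have hAδ_sq : MemLp (fun o => ind A o * condProbShift m P A S s t o ^ 2) ∞ P :=
    hδ_sq.mul' (memLp_ind ∞ hA)
  have h_half : (1 / 2) * ∫ o, ind A o * condProbShift m P A S s t o ^ 2 ∂P ≤
      ∫ o, (1 + t * s o) * (ind A o * condProbShift m P A S s t o ^ 2) ∂P := by
    rw [← integral_const_mul]
    refine integral_mono_ae ((hAδ_sq.integrable le_top).const_mul _)
      (((integrable_const 1).add (hs.const_mul t)).mul_of_top_left hAδ_sq) ?_
    filter_upwards [ht] with o ho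
    exact mul_le_mul_of_nonneg_right ho (mul_nonneg (ind_nonneg A o) (sq_nonneg _))
  have h_residual := abs_integral_mul_le (hs.abs.mul_of_top_left hδ.abs)
    ((abs_ind_mul_residual_le hm H hA hS _).mono fun _ ho => ho.trans_eq (one_mul _).symm)
  calc c * ∫ o, condProbShift m P A S s t o ^ 2 ∂P
      ≤ ∫ o, ind A o * condProbShift m P A S s t o ^ 2 ∂P :=
        H.mul_integral_le hm hA (stronglyMeasurable_condProbShift.pow 2)
          (hδ_sq.integrable le_top) (.of_forall fun o => sq_nonneg _)
    _ ≤ 2 * (t * ∫ o, s o * (ind A o * (condProbShift m P A S s t o *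
          (ind S o - condProbOn m P A S o))) ∂P) := by
        rw [← integral_ind_mul_condProbShift_sq hm H hA hS hs ht0]
        linarith
    _ ≤ 2 * (|t| * ∫ o, |s o| * |condProbShift m P A S s t o| ∂P) := by
        rw [one_mul] at h_residual
        refine mul_le_mul_of_nonneg_left ?_ zero_le_two
        exact (le_abs_self _).trans ((abs_mul _ _).trans_le
          (mul_le_mul_of_nonneg_left h_residual (abs_nonneg t)))
    _ = _ := (mul_assoc _ _ _).symm

lemma integral_abs_mul_condProbShift_le (hs : MemLp s 2 P)
    (ht : ∀ᵐ o ∂P, 1 / 2 ≤ 1 + t * s o) :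
    ∫ o, |s o| * |condProbShift m P A S s t o| ∂P ≤ 2 / c * |t| * ∫ o, s o ^ 2 ∂P := by
  have hs1 : Integrable s P := hs.integrable one_le_two
  have hδ : MemLp (condProbShift m P A S s t) 2 P :=
    (memLp_top_condProbShift hm H hA hS hs1
      (ht.mono fun _ => one_half_pos.trans_le)).mono_exponent le_top
  have h_lower := mul_integral_condProbShift_sq_le hm H hA hS hs1 ht
  have h_cauchy : (∫ o, |s o| * |condProbShift m P A S s t o| ∂P) ^ 2 ≤
      (∫ o, s o ^ 2 ∂P) * ∫ o, condProbShift m P A S s t o ^ 2 ∂P := by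
    simpa only [Pi.abs_apply, sq_abs] using sq_integral_mul_le hs.abs hδ.abs
  set T := ∫ o, |s o| * |condProbShift m P A S s t o| ∂P
  have hT : 0 ≤ T := integral_nonneg fun o => by positivity
  have hE : 0 ≤ ∫ o, s o ^ 2 ∂P := integral_nonneg fun o => sq_nonneg _
  have hc := H.pos
  rcases hT.eq_or_lt with hT0 | hT0
  · rw [← hT0]
    positivity
  · have h_quad : T * (c * T) ≤ T * (2 * |t| * ∫ o, s o ^ 2 ∂P) := by
      nlinarith [mul_le_mul_of_nonneg_left h_cauchy hc.le,
        mul_le_mul_of_nonneg_left h_lower hE]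
    have h_lin := le_of_mul_le_mul_left h_quad hT0
    rw [div_mul_eq_mul_div, div_mul_eq_mul_div, le_div_iff₀ hc]
    linarith

lemma attritionMoment_perturb_eq (hs : Integrable s P) (ht : ∀ᵐ o ∂P, 0 < 1 + t * s o) :
    attritionMoment m (perturb P s t) A S p = attritionMoment m P A S p +
      t * ∫ o, momentGradient m P A S p o * s o ∂P +
        t * ∫ o, s o * (oddsContrast m P A o * condProbShift m P A S s t o) ∂P := by
  have := isFiniteMeasure_perturb hs t
  have ht0 : ∀ᵐ o ∂P, 0 ≤ 1 + t * s o := ht.mono fun _ => le_of_lt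
  have hψ := memLp_top_momentGradient (p := p) hm H hA hS
  have hδ := memLp_top_condProbShift hm H hA hS hs ht
  have hκδ : MemLp (fun o => oddsContrast m P A o * condProbShift m P A S s t o) ∞ P :=
    hδ.mul' (memLp_top_oddsContrast hm H hA)
  have h_gradient := integral_perturb_eq_add hs.aemeasurable ht0 (hψ.integrable le_top)
    (hs.mul_of_top_left hψ)
  have h_contrast := integral_perturb_eq_add hs.aemeasurable ht0 (hκδ.integrable le_top)
    (hs.mul_of_top_left hκδ)
  rw [integral_oddsContrast_mul hm H hA stronglyMeasurable_condProbShift (hδ.integrable le_top),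
    zero_add] at h_contrast
  have h_split := attritionMoment_sub_integral_momentGradient (p := p) hm H hA hS
    (absolutelyContinuous_perturb hs.aemeasurable ht) perturb_absolutelyContinuous
  rw [h_gradient, integral_momentGradient hm H hA hS] at h_split
  simp_rw [mul_comm (momentGradient m P A S p _)]
  linarith [h_split.trans h_contrast]

theorem abs_attritionMoment_perturb_sub_le (hs : MemLp s 2 P)
    (ht : ∀ᵐ o ∂P, 1 / 2 ≤ 1 + t * s o) :
    |attritionMoment m (perturb P s t) A S p - attritionMoment m P A S p -
        t * ∫ o, momentGradient m P A S p o * s o ∂P| ≤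
      (1 + 1 / c) * (2 / c * ∫ o, s o ^ 2 ∂P) * t ^ 2 := by
  have hs1 : Integrable s P := hs.integrable one_le_two
  have ht0 : ∀ᵐ o ∂P, 0 < 1 + t * s o := ht.mono fun _ => one_half_pos.trans_le
  have hδ := memLp_top_condProbShift hm H hA hS hs1 ht0
  have hc := H.pos
  have h_contrast : ∀ᵐ o ∂P, |oddsContrast m P A o * condProbShift m P A S s t o| ≤
      (1 + 1 / c) * |condProbShift m P A S s t o| := by
    filter_upwards [abs_oddsContrast_le hm H hA] with o ho
    rw [abs_mul]
    gcongr
  calc _ = |t| * |∫ o, s o * (oddsContrast m P A o * condProbShift m P A S s t o) ∂P| := by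
        rw [attritionMoment_perturb_eq hm H hA hS hs1 ht0, ← abs_mul]
        congr 1
        ring
    _ ≤ |t| * ((1 + 1 / c) * (2 / c * |t| * ∫ o, s o ^ 2 ∂P)) := by
        gcongr
        exact (abs_integral_mul_le (hs1.abs.mul_of_top_left hδ.abs) h_contrast).trans
          (by gcongr; exact integral_abs_mul_condProbShift_le hm H hA hS hs ht)
    _ = _ := by
        rw [← sq_abs t]
        ring

end Shift

lemma integral_ind_compl_mul_condProbOn (hm : m ≤ mO) (H : UniformPositivity m P A c)
    (hA : MeasurableSet A) (hS : MeasurableSet S) :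
    ∫ o, ind Aᶜ o * condProbOn m P A S o ∂P = ∫ o, ind A o * (condOdds m P A o * ind S o) ∂P := by
  have hn := memLp_top_condProbOn hm H hA hS .rfl
  have hρ := memLp_top_condOdds hm H hA
  have hρS : Integrable (fun o => ind A o * (condOdds m P A o * ind S o)) P :=
    integrable_ind_mul hA ((hρ.integrable le_top).mul_of_top_left (memLp_ind ∞ hS))
  have hρn : Integrable (fun o => ind A o * (condOdds m P A o * condProbOn m P A S o)) P :=
    integrable_ind_mul hA ((hρ.integrable le_top).mul_of_top_left hn)
  rw [integral_ind_compl_mul hm H hA stronglyMeasurable_condProbOn (hn.integrable le_top), eq_comm,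
    ← sub_eq_zero, ← integral_sub hρS hρn]
  simpa only [mul_sub] using
    integral_residual_eq_zero hm hA hS stronglyMeasurable_condOdds (hρ.integrable le_top)

lemma sq_momentGradient_sub_le (hm : m ≤ mO) (H : UniformPositivity m P A c)
    (hA : MeasurableSet A) (hS : MeasurableSet S) (hS' : MeasurableSet S') (hSS' : S ⊆ S') :
    ∀ᵐ o ∂P, (momentGradient m P A S' p o - momentGradient m P A S p o) ^ 2 ≤
      ind Aᶜ o * (condProbOn m P A S' o - condProbOn m P A S o) +
        1 / c * (ind A o * (condOdds m P A o * (ind S' o - ind S o)) +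
          ind A o * (condOdds m P A o * (condProbOn m P A S' o - condProbOn m P A S o))) := by
  filter_upwards [condOdds_mem_Icc hm H hA, condProbOn_mem_Icc hm H hA hS .rfl,
    condProbOn_mem_Icc hm H hA hS' .rfl, condProbOn_mono hm H hA hS hS' hSS' .rfl]
    with o ⟨hρ0, hρ1⟩ ⟨hn0, _⟩ ⟨_, hn1⟩ hδ
  have hc := H.pos
  have hD0 : 0 ≤ ind S' o - ind S o :=
    sub_nonneg.2 (indicator_le_indicator_of_subset hSS' (fun _ => zero_le_one) o)
  have hD1 : ind S' o - ind S o ≤ 1 := by linarith [ind_le_one S' o, ind_nonneg S o]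
  have hδ0 : 0 ≤ condProbOn m P A S' o - condProbOn m P A S o := sub_nonneg.2 hδ
  have hδ1 : condProbOn m P A S' o - condProbOn m P A S o ≤ 1 := by linarith
  simp only [momentGradient]
  generalize ind S' o = i' at *
  generalize ind S o = i at *
  generalize condProbOn m P A S' o = n' at *
  generalize condProbOn m P A S o = n at *
  generalize condOdds m P A o = ρ at *
  by_cases ho : o ∈ A
  · simp only [ho, ind, mem_compl_iff, not_true_eq_false, not_false_eq_true,
      indicator_of_notMem, indicator_of_mem, zero_mul, one_mul, zero_add]
    calc (ρ * (i' - n') - ρ * (i - n)) ^ 2 = ρ * (ρ * ((i' - i) - (n' - n)) ^ 2) := by ring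
      _ ≤ 1 / c * (ρ * ((i' - i) + (n' - n))) := by
          gcongr
          nlinarith [mul_nonneg hD0 hδ0, mul_nonneg hD0 (sub_nonneg.2 hD1),
            mul_nonneg hδ0 (sub_nonneg.2 hδ1)]
      _ = _ := by ring
  · simp only [ho, ind, mem_compl_iff, not_false_eq_true, indicator_of_notMem, indicator_of_mem,
      zero_mul, one_mul, add_zero, mul_zero]
    nlinarith

lemma attritionMoment_sub_eq (hm : m ≤ mO) (H : UniformPositivity m P A c)
    (hA : MeasurableSet A) (hS : MeasurableSet S) (hS' : MeasurableSet S') :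
    attritionMoment m P A S' p - attritionMoment m P A S p =
      ∫ o, ind Aᶜ o * (condProbOn m P A S' o - condProbOn m P A S o) ∂P := by
  have h_int : ∀ {S : Set 𝒪}, MeasurableSet S →
      Integrable (fun o => ind Aᶜ o * (condProbOn m P A S o - p)) P := fun hS =>
    integrable_ind_mul hA.compl
      (((memLp_top_condProbOn hm H hA hS .rfl).sub (memLp_const p)).integrable le_top)
  rw [attritionMoment, attritionMoment, ← integral_sub (h_int hS') (h_int hS)]
  exact integral_congr_ae (.of_forall fun o => by ring)

lemma integral_odds_mul_ind_sub_eq (hm : m ≤ mO) (H : UniformPositivity m P A c)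
    (hA : MeasurableSet A) (hS : MeasurableSet S) (hS' : MeasurableSet S') :
    ∫ o, ind A o * (condOdds m P A o * (ind S' o - ind S o)) ∂P =
      ∫ o, ind Aᶜ o * (condProbOn m P A S' o - condProbOn m P A S o) ∂P := by
  have hρ := (memLp_top_condOdds hm H hA).integrable le_top
  have hn := (memLp_top_condProbOn hm H hA hS .rfl).integrable le_top
  have hn' := (memLp_top_condProbOn hm H hA hS' .rfl).integrable le_top
  simp_rw [mul_sub]
  rw [integral_sub, integral_sub, integral_ind_compl_mul_condProbOn hm H hA hS,
    integral_ind_compl_mul_condProbOn hm H hA hS']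
  exacts [integrable_ind_mul hA.compl hn', integrable_ind_mul hA.compl hn,
    integrable_ind_mul hA (hρ.mul_of_top_left (memLp_ind ∞ hS')),
    integrable_ind_mul hA (hρ.mul_of_top_left (memLp_ind ∞ hS))]

lemma integral_sq_momentGradient_sub_le (hm : m ≤ mO) (H : UniformPositivity m P A c)
    (hA : MeasurableSet A) (hS : MeasurableSet S) (hS' : MeasurableSet S') (hSS' : S ⊆ S') :
    ∫ o, (momentGradient m P A S' p o - momentGradient m P A S p o) ^ 2 ∂P ≤
      (1 + 2 / c) * (attritionMoment m P A S' p - attritionMoment m P A S p) := by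
  have hρ := (memLp_top_condOdds hm H hA).integrable le_top
  have hδ := (memLp_top_condProbOn hm H hA hS' .rfl).sub (memLp_top_condProbOn hm H hA hS .rfl)
  have hδ_int : Integrable
      (fun o => ind Aᶜ o * (condProbOn m P A S' o - condProbOn m P A S o)) P :=
    integrable_ind_mul hA.compl (hδ.integrable le_top)
  have hρD : Integrable (fun o => ind A o * (condOdds m P A o * (ind S' o - ind S o))) P :=
    integrable_ind_mul hA (hρ.mul_of_top_left ((memLp_ind ∞ hS').sub (memLp_ind ∞ hS)))
  have hρδ : Integrable (fun o => ind A o *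
      (condOdds m P A o * (condProbOn m P A S' o - condProbOn m P A S o))) P :=
    integrable_ind_mul hA (hρ.mul_of_top_left hδ)
  have h_odds := integral_ind_compl_mul hm H hA
    (stronglyMeasurable_condProbOn.sub stronglyMeasurable_condProbOn) (hδ.integrable le_top)
  have hψ : MemLp (fun o => momentGradient m P A S' p o - momentGradient m P A S p o) ∞ P :=
    (memLp_top_momentGradient hm H hA hS').sub (memLp_top_momentGradient hm H hA hS)
  calc ∫ o, (momentGradient m P A S' p o - momentGradient m P A S p o) ^ 2 ∂P
      ≤ _ := integral_mono_ae (hψ.mono_exponent le_top).integrable_sq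
        (hδ_int.add ((hρD.add hρδ).const_mul (1 / c)))
        (sq_momentGradient_sub_le hm H hA hS hS' hSS')
    _ = (1 + 2 / c) * ∫ o, ind Aᶜ o * (condProbOn m P A S' o - condProbOn m P A S o) ∂P := by
        simp only [Pi.sub_apply] at h_odds
        rw [integral_add' hδ_int ((hρD.add hρδ).const_mul (1 / c)), integral_const_mul,
          integral_add' hρD hρδ, integral_odds_mul_ind_sub_eq hm H hA hS hS', ← h_odds]
        ring
    _ = _ := by rw [attritionMoment_sub_eq hm H hA hS hS']

lemma sq_integral_momentGradient_sub_le (hm : m ≤ mO) (H : UniformPositivity m P A c)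
    (hA : MeasurableSet A) (hS : MeasurableSet S) (hS' : MeasurableSet S') (hSS' : S ⊆ S')
    (hs : MemLp s 2 P) :
    (∫ o, momentGradient m P A S' p o * s o ∂P - ∫ o, momentGradient m P A S p o * s o ∂P) ^ 2 ≤
      (1 + 2 / c) * (attritionMoment m P A S' p - attritionMoment m P A S p) *
        ∫ o, s o ^ 2 ∂P := by
  have hs1 : Integrable s P := hs.integrable one_le_two
  have hψ := memLp_top_momentGradient (p := p) hm H hA hS
  have hψ' := memLp_top_momentGradient (p := p) hm H hA hS'
  have hψs : Integrable (fun o => momentGradient m P A S p o * s o) P := hs1.mul_of_top_right hψ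
  have hψs' : Integrable (fun o => momentGradient m P A S' p o * s o) P :=
    hs1.mul_of_top_right hψ'
  rw [← integral_sub hψs' hψs]
  simp_rw [← sub_mul]
  exact (sq_integral_mul_le ((hψ'.sub hψ).mono_exponent le_top) hs).trans
    (mul_le_mul_of_nonneg_right (integral_sq_momentGradient_sub_le hm H hA hS hS' hSS')
      (integral_nonneg fun o => sq_nonneg _))

end Expansion

section GeneralizedInverse

open Filter Topology Asymptotics

lemma sInf_mem_Icc_of_monotone {g : ℝ → ℝ} (hg : Monotone g) {l u : ℝ} (hl : g l < 0)
    (hu : 0 ≤ g u) : sInf {v | 0 ≤ g v} ∈ Icc l u := by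
  have h_lower : l ∈ lowerBounds {v | 0 ≤ g v} := fun v hv =>
    (hg.reflect_lt (hl.trans_le hv)).le
  exact ⟨le_csInf ⟨u, hu⟩ h_lower, csInf_le ⟨l, h_lower⟩ hu⟩

lemma sInf_eq_of_hasDerivAt {g : ℝ → ℝ} (hg : Monotone g) {b η : ℝ} (hb : 0 < b)
    (h_deriv : HasDerivAt g b η) (hη : g η = 0) : sInf {v | 0 ≤ g v} = η := by
  refine IsLeast.csInf_eq ⟨hη.ge, fun v hv => ?_⟩
  by_contra! hvη
  have h_neg : ∀ᶠ u in 𝓝[<] η, g u < 0 := by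
    have h_slope := (hasDerivAt_iff_tendsto_slope_left_right.1 h_deriv).1.eventually
      (eventually_gt_nhds hb)
    filter_upwards [h_slope, self_mem_nhdsWithin] with u hu (huη : u < η)
    rw [slope_def_field, hη, sub_zero] at hu
    by_contra! h_nonneg
    exact hu.not_ge (div_nonpos_of_nonneg_of_nonpos h_nonneg (sub_neg.2 huη).le)
  obtain ⟨u, hu, hvu⟩ := (h_neg.and (Ioo_mem_nhdsLT hvη)).exists
  exact (hu.trans_le hv).not_ge (hg hvu.1.le)

section Path

variable {G : ℝ → ℝ → ℝ} {a : ℝ → ℝ} {T : Set ℝ} {b η K : ℝ}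

lemma isLittleO_apply_sub (hG : HasDerivAt (G 0) b η) (hη : G 0 η = 0) (ha : ContinuousAt a η)
    (h_exp : ∀ᶠ t in 𝓝[T] 0, ∀ v, |G t v - (G 0 v + t * a v)| ≤ K * t ^ 2) {d : ℝ}
    (hd : b * d + a η = 0) (e : ℝ) :
    (fun t => G t (η + (t * d + e * |t|)) - b * e * |t|) =o[𝓝[T] 0] fun t => t := by
  have h_small : Tendsto (fun t : ℝ => η + (t * d + e * |t|)) (𝓝[T] 0) (𝓝 η) := by
    have h_cont : Continuous fun t : ℝ => η + (t * d + e * |t|) := by fun_prop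
    simpa using (h_cont.tendsto 0).mono_left nhdsWithin_le_nhds
  have h_step : (fun t : ℝ => t * d + e * |t|) =O[𝓝[T] 0] fun t => t := by
    simp only [mul_comm _ d]
    exact (isBigO_const_mul_self d _ _).add ((isBigO_refl _ _).norm_left.const_mul_left e)
  have h_expansion : (fun t => G t (η + (t * d + e * |t|)) -
      (G 0 (η + (t * d + e * |t|)) + t * a (η + (t * d + e * |t|)))) =o[𝓝[T] 0] fun t => t := by
    have h_sq : (fun t : ℝ => t ^ 2) =o[𝓝[T] 0] fun t => t := by
      simpa only [pow_one] using
        (isLittleO_pow_pow (𝕜 := ℝ) one_lt_two).mono nhdsWithin_le_nhds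
    refine (IsBigO.of_bound K ?_).trans_isLittleO h_sq
    filter_upwards [h_exp] with t ht
    simpa only [Real.norm_eq_abs, abs_pow, sq_abs] using ht _
  have h_linear : (fun t => G 0 (η + (t * d + e * |t|)) - b * (t * d + e * |t|))
      =o[𝓝[T] 0] fun t => t := by
    have h := (hasDerivAt_iff_isLittleO.1 hG).comp_tendsto h_small
    simp only [Function.comp_def, hη, sub_zero, add_sub_cancel_left, smul_eq_mul,
      mul_comm _ b] at h
    exact h.trans_isBigO h_step
  have h_slope : (fun t => t * (a (η + (t * d + e * |t|)) - a η)) =o[𝓝[T] 0] fun t => t := by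
    have h := (isBigO_refl (fun t : ℝ => t) (𝓝[T] 0)).mul_isLittleO
      ((isLittleO_one_iff ℝ).2 (tendsto_sub_nhds_zero_iff.2 (ha.tendsto.comp h_small)))
    simpa only [mul_one, Function.comp_apply] using h
  refine ((h_expansion.add h_linear).add h_slope).congr_left fun t => ?_
  linear_combination (-t) * hd

theorem hasDerivWithinAt_sInf (hb : 0 < b) (hG : HasDerivAt (G 0) b η) (hη : G 0 η = 0)
    (ha : ContinuousAt a η) (hT : 0 ∈ T) (hmono : ∀ᶠ t in 𝓝[T] 0, Monotone (G t))
    (h_exp : ∀ᶠ t in 𝓝[T] 0, ∀ v, |G t v - (G 0 v + t * a v)| ≤ K * t ^ 2) :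
    HasDerivWithinAt (fun t => sInf {v | 0 ≤ G t v}) (-(a η) / b) T 0 := by
  set d := -(a η) / b with hd_def
  have hd : b * d + a η = 0 := by
    rw [hd_def]
    field_simp
    ring
  have h_zero : sInf {v | 0 ≤ G 0 v} = η :=
    sInf_eq_of_hasDerivAt (hmono.self_of_nhdsWithin hT) hb hG hη
  rw [hasDerivWithinAt_iff_isLittleO, isLittleO_iff]
  intro ε hε
  simp only [h_zero, sub_zero, smul_eq_mul, Real.norm_eq_abs]
  have h_half : 0 < b * ε / 2 := by positivity
  filter_upwards [hmono, (isLittleO_apply_sub hG hη ha h_exp hd ε).def h_half,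
    (isLittleO_apply_sub hG hη ha h_exp hd (-ε)).def h_half] with t hm h_above h_below
  rcases eq_or_ne t 0 with rfl | ht
  · simp [h_zero]
  rw [Real.norm_eq_abs, Real.norm_eq_abs, abs_le] at h_above h_below
  have h_pos : 0 < b * ε * |t| := by positivity
  have h_bracket := sInf_mem_Icc_of_monotone hm
    (show G t (η + (t * d + -ε * |t|)) < 0 by linarith [h_below.2])
    (show 0 ≤ G t (η + (t * d + ε * |t|)) by linarith [h_above.1])
  exact abs_le.2 ⟨by linarith [h_bracket.1], by linarith [h_bracket.2]⟩

end Path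

section LeftLimit

variable {F H : ℝ → ℝ} {η f : ℝ}

lemma apply_eq_of_squeeze (hF : ContinuousAt F η) (h_le : H ≤ F)
    (h_ge : ∀ u v, u < v → F u ≤ H v) : H η = F η := by
  refine le_antisymm (h_le η) ?_
  have h_left : Tendsto F (𝓝[<] η) (𝓝 (F η)) := hF.tendsto.mono_left nhdsWithin_le_nhds
  exact le_of_tendsto h_left (by filter_upwards [self_mem_nhdsWithin] with u hu using h_ge u η hu)

lemma hasDerivAt_of_squeeze (hF : HasDerivAt F f η) (h_le : H ≤ F)
    (h_ge : ∀ u v, u < v → F u ≤ H v) : HasDerivAt H f η := by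
  have hη := apply_eq_of_squeeze hF.continuousAt h_le h_ge
  -- Probing `F` at `v - (v - η) ^ 2 < v` costs only a second-order error.
  have h_shift : HasDerivAt (fun v => F (v - (v - η) ^ 2)) f η := by
    have h_inner : HasDerivAt (fun v : ℝ => v - (v - η) ^ 2) 1 η :=
      ((hasDerivAt_id' η).fun_sub (((hasDerivAt_id' η).sub_const η).fun_pow 2)).congr_deriv
        (by simp)
    have hF' : HasDerivAt F f (η - (η - η) ^ 2) := by simpa using hF
    simpa only [mul_one, Function.comp_def] using hF'.comp η h_inner
  rw [hasDerivAt_iff_isLittleO, isLittleO_iff] at hF h_shift ⊢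
  intro ε hε
  filter_upwards [hF hε, h_shift hε] with v h_above h_below
  simp only [sub_self, ne_eq, OfNat.ofNat_ne_zero, not_false_eq_true, zero_pow, sub_zero,
    Real.norm_eq_abs, abs_le, hη] at h_above h_below ⊢
  have h_lower : F (v - (v - η) ^ 2) ≤ H v := by
    rcases eq_or_ne v η with rfl | hv
    · simp [hη]
    · exact h_ge _ _ (sub_lt_self v (sq_pos_of_ne_zero (sub_ne_zero.2 hv)))
  have h_upper := h_le v
  constructor <;> linarith

end LeftLimit

end GeneralizedInverse

section QuantilePath

open Filter Topology

variable {𝒪 : Type*} {m mO : MeasurableSpace 𝒪} {P Q : Measure 𝒪} {A S S' : Set 𝒪}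
  {U s : 𝒪 → ℝ} {b c η p : ℝ}

/-- The `p`-quantile of `U` on the unobserved event `Aᶜ` as predicted from `A`, that is, for the
distribution function `v ↦ E_Q[Q(U < v | m, A) | Aᶜ]`. -/
def attritionQuantile (m : MeasurableSpace 𝒪) {_ : MeasurableSpace 𝒪} (Q : Measure 𝒪) (A : Set 𝒪)
    (U : 𝒪 → ℝ) (p : ℝ) : ℝ :=
  sInf {v | p ≤ ∫ o, condProbOn m Q A {o | U o < v} o ∂(cond Q Aᶜ)}

section Moment

variable [IsFiniteMeasure P] [IsFiniteMeasure Q] (hm : m ≤ mO) (H : UniformPositivity m P A c)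
  (hA : MeasurableSet A) (hPQ : P ≪ Q) (hQP : Q ≪ P)

include hm H hA hPQ hQP

lemma attritionMoment_mono (hS : MeasurableSet S) (hS' : MeasurableSet S') (hSS' : S ⊆ S') :
    attritionMoment m Q A S p ≤ attritionMoment m Q A S' p := by
  have h_int {S : Set 𝒪} (hS : MeasurableSet S) :
      Integrable (fun o => ind Aᶜ o * (condProbOn m Q A S o - p)) Q :=
    integrable_ind_mul hA.compl
      ((integrable_of_memLp_top (memLp_top_condProbOn hm H hA hS hPQ) hQP).sub
        (integrable_const p))
  refine integral_mono_ae (h_int hS) (h_int hS') ?_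
  filter_upwards [hQP.ae_le (condProbOn_mono hm H hA hS hS' hSS' hPQ)] with o ho
  exact mul_le_mul_of_nonneg_left (sub_le_sub_right ho p) (ind_nonneg _ _)

lemma attritionMoment_eq (hS : MeasurableSet S) (hAc : Q Aᶜ ≠ 0) :
    attritionMoment m Q A S p = Q.real Aᶜ * (∫ o, condProbOn m Q A S o ∂(cond Q Aᶜ) - p) := by
  have := cond_isProbabilityMeasure hAc
  have hn := integrable_cond
    (integrable_of_memLp_top (memLp_top_condProbOn hm H hA hS hPQ) hQP) Aᶜ
  rw [attritionMoment, integral_ind_mul hA.compl, integral_sub hn (integrable_const p),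
    integral_const, probReal_univ, one_smul]

lemma attritionQuantile_eq_sInf (hU : Measurable U) (hAc : Q Aᶜ ≠ 0) :
    attritionQuantile m Q A U p = sInf {v | 0 ≤ attritionMoment m Q A {o | U o < v} p} := by
  have h_pos : 0 < Q.real Aᶜ := measureReal_nonneg.lt_of_ne' ((measureReal_ne_zero_iff).2 hAc)
  simp only [attritionQuantile, attritionMoment_eq hm H hA hPQ hQP
    (measurableSet_lt hU measurable_const) hAc, mul_nonneg_iff_of_pos_left h_pos, sub_nonneg]

end Moment

section Path

variable [IsFiniteMeasure P] (hm : m ≤ mO) (H : UniformPositivity m P A c)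
  (hA : MeasurableSet A) (hU : Measurable U) (hs : MemLp s 2 P)

include hm H hA hU hs

lemma continuousAt_integral_momentGradient
    (h_cont : ContinuousAt (fun v => attritionMoment m P A {o | U o < v} p) η) :
    ContinuousAt (fun v => ∫ o, momentGradient m P A {o | U o < v} p o * s o ∂P) η := by
  set M := fun v => attritionMoment m P A {o | U o < v} p
  set a := fun v => ∫ o, momentGradient m P A {o | U o < v} p o * s o ∂P
  have hS (v : ℝ) : MeasurableSet {o | U o < v} := measurableSet_lt hU measurable_const
  have h_sq {u v : ℝ} (huv : u ≤ v) :
      (a v - a u) ^ 2 ≤ (1 + 2 / c) * (M v - M u) * ∫ o, s o ^ 2 ∂P :=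
    sq_integral_momentGradient_sub_le hm H hA (hS u) (hS v) (fun _ ho => ho.trans_le huv) hs
  have h_bound (v : ℝ) :
      |a v - a η| ≤ √((1 + 2 / c) * |M v - M η| * ∫ o, s o ^ 2 ∂P) := by
    have hc := H.pos
    have : 0 ≤ ∫ o, s o ^ 2 ∂P := integral_nonneg fun o => sq_nonneg (s o)
    refine Real.abs_le_sqrt ?_
    rcases le_total η v with h | h
    · refine (h_sq h).trans ?_
      gcongr
      exact le_abs_self _
    · rw [← neg_sub, neg_sq, abs_sub_comm]
      refine (h_sq h).trans ?_
      gcongr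
      exact le_abs_self _
  rw [ContinuousAt, tendsto_iff_dist_tendsto_zero]
  refine squeeze_zero (fun _ => dist_nonneg) h_bound ?_
  have h_sqrt : ContinuousAt (fun v => √((1 + 2 / c) * |M v - M η| * ∫ o, s o ^ 2 ∂P)) η :=
    ((continuousAt_const.mul (h_cont.sub continuousAt_const).abs).mul continuousAt_const).sqrt
  simpa [ContinuousAt] using h_sqrt

theorem hasDerivWithinAt_attritionQuantile_perturb (hAc : P Aᶜ ≠ 0) (hb : 0 < b)
    (h_deriv : HasDerivAt (fun v => attritionMoment m P A {o | U o < v} p) b η)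
    (h_zero : attritionMoment m P A {o | U o < η} p = 0) :
    HasDerivWithinAt (fun t => attritionQuantile m (perturb P s t) A U p)
      (-(∫ o, momentGradient m P A {o | U o < η} p o * s o ∂P) / b) (validTimes P s) 0 := by
  have hs1 : Integrable s P := hs.integrable one_le_two
  have hS (v : ℝ) : MeasurableSet {o | U o < v} := measurableSet_lt hU measurable_const
  have h_half := eventually_half_le_perturb_density P s
  have h_ac : ∀ᶠ t in 𝓝[validTimes P s] 0, P ≪ perturb P s t := h_half.mono fun t ht =>
    absolutelyContinuous_perturb hs1.aemeasurable (ht.mono fun _ => one_half_pos.trans_le)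
  have h_sInf := hasDerivWithinAt_sInf (T := validTimes P s)
    (G := fun t v => attritionMoment m (perturb P s t) A {o | U o < v} p) hb
    (by simpa only [perturb_zero] using h_deriv) (by simpa only [perturb_zero] using h_zero)
    (continuousAt_integral_momentGradient hm H hA hU hs h_deriv.continuousAt)
    (zero_mem_validTimes P s)
    (by
      filter_upwards [h_ac] with t hPt u v huv
      have := isFiniteMeasure_perturb hs1 t
      exact attritionMoment_mono hm H hA hPt perturb_absolutelyContinuous (hS u) (hS v)
        fun _ ho => ho.trans_le huv)
    (by
      filter_upwards [h_half] with t ht v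
      simpa only [perturb_zero, sub_sub] using
        abs_attritionMoment_perturb_sub_le hm H hA (hS v) hs ht)
  refine h_sInf.congr_of_eventuallyEq_of_mem ?_ (zero_mem_validTimes P s)
  filter_upwards [h_ac] with t hPt
  have := isFiniteMeasure_perturb hs1 t
  exact attritionQuantile_eq_sInf hm H hA hPt perturb_absolutelyContinuous hU
    (mt (fun h => hPt h) hAc)

end Path

theorem isEfficientInfluenceFunction_attritionQuantile [IsProbabilityMeasure P] (hm : m ≤ mO)
    (H : UniformPositivity m P A c) (hA : MeasurableSet A) (hU : Measurable U)
    (hAc : P Aᶜ ≠ 0) {f : ℝ} (hf : 0 < f)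
    (h_deriv : HasDerivAt (fun v => ∫ o, condProbOn m P A {o | U o < v} o ∂(cond P Aᶜ)) f η)
    (h_val : ∫ o, condProbOn m P A {o | U o < η} o ∂(cond P Aᶜ) = p) :
    IsEfficientInfluenceFunction (fun Q => attritionQuantile m Q A U p) P
      (fun o => -1 / (P.real Aᶜ * f) * momentGradient m P A {o | U o < η} p o) := by
  have hS (v : ℝ) : MeasurableSet {o | U o < v} := measurableSet_lt hU measurable_const
  have h_pos : 0 < P.real Aᶜ := ENNReal.toReal_pos hAc (measure_ne_top P _)
  have h_moment (v : ℝ) : attritionMoment m P A {o | U o < v} p =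
      P.real Aᶜ * (∫ o, condProbOn m P A {o | U o < v} o ∂(cond P Aᶜ) - p) :=
    attritionMoment_eq hm H hA .rfl .rfl (hS v) hAc
  have h_zero : attritionMoment m P A {o | U o < η} p = 0 := by
    rw [h_moment, h_val, sub_self, mul_zero]
  have h_moment_deriv :
      HasDerivAt (fun v => attritionMoment m P A {o | U o < v} p) (P.real Aᶜ * f) η := by
    simp_rw [h_moment]
    exact (h_deriv.sub_const _).const_mul _
  have h_gradient : MemLp (momentGradient m P A {o | U o < η} p) 2 P :=
    (memLp_top_momentGradient hm H hA (hS η)).mono_exponent le_top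
  have h_influence : IsInfluenceFunction (fun Q => attritionQuantile m Q A U p) P
      (fun o => -1 / (P.real Aᶜ * f) * momentGradient m P A {o | U o < η} p o) := by
    refine ⟨h_gradient.const_mul _, ?_, fun s hs _ => ?_⟩
    · rw [integral_const_mul, integral_momentGradient hm H hA (hS η), h_zero, mul_zero]
    · convert hasDerivWithinAt_attritionQuantile_perturb hm H hA hU hs hAc (mul_pos h_pos hf)
        h_moment_deriv h_zero using 1
      simp_rw [mul_assoc]
      rw [integral_const_mul]
      ring
  exact ⟨h_influence, fun φ hφ => hφ.ae_eq h_influence⟩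

end QuantilePath

section ConditionalIndependence

variable {Ω 𝒪 β γ 𝒲 : Type*} [MeasurableSpace Ω] {μ : Measure Ω} [IsFiniteMeasure μ]

lemma condExp_map_comp {m mO : MeasurableSpace 𝒪} (hm : m ≤ mO) {T : Ω → 𝒪} (hT : Measurable T)
    {f : 𝒪 → ℝ} (hf : Integrable f (μ.map T)) :
    condExp m (μ.map T) f ∘ T =ᵐ[μ] condExp (m.comap T) μ (f ∘ T) := by
  refine ae_eq_condExp_of_forall_setIntegral_eq ((MeasurableSpace.comap_mono hm).trans hT.comap_le)
    (hf.comp_measurable hT) (fun _ _ _ => (integrable_condExp.comp_measurable hT).integrableOn)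
    ?_ (stronglyMeasurable_condExp.comp_measurable (comap_measurable T)).aestronglyMeasurable
  rintro _ ⟨B, hB, rfl⟩ _
  have h_set := setIntegral_condExp hm hf hB
  rwa [setIntegral_map (hm _ hB) integrable_condExp.1 hT.aemeasurable,
    setIntegral_map (hm _ hB) hf.1 hT.aemeasurable] at h_set

variable [StandardBorelSpace Ω] [MeasurableSpace 𝒲] {mβ : MeasurableSpace β}
  {mγ : MeasurableSpace γ} [StandardBorelSpace β] [Nonempty β] [StandardBorelSpace γ] [Nonempty γ]
  {Z : Ω → β} {R : Ω → γ} {W : Ω → 𝒲} {s : Set γ}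

lemma condExp_ind_preimage_of_condIndepFun (hZ : Measurable Z) (hR : Measurable R)
    (hW : Measurable W) (h_indep : Z ⟂ᵢ[W, hW; μ] R) (hs : MeasurableSet s) :
    condExp (MeasurableSpace.comap (fun ω => (W ω, Z ω)) inferInstance) μ (ind (R ⁻¹' s)) =ᵐ[μ]
      condExp (MeasurableSpace.comap W inferInstance) μ (ind (R ⁻¹' s)) := by
  have hWZ : Measurable fun ω => (W ω, Z ω) := hW.prodMk hZ
  have h_distrib := ae_of_ae_map hWZ.aemeasurable
    ((condIndepFun_iff_condDistrib_prod_ae_eq_prodMkRight hR hZ hW).1 h_indep)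
  filter_upwards [h_distrib, condDistrib_ae_eq_condExp (μ := μ) hWZ hR hs,
    condDistrib_ae_eq_condExp (μ := μ) hW hR hs] with ω h hWZ hW
  rw [← hWZ, ← hW, h, Kernel.prodMkRight_apply]

lemma integral_ind_preimage_mul_of_condIndepFun (hZ : Measurable Z) (hR : Measurable R)
    (hW : Measurable W) (h_indep : Z ⟂ᵢ[W, hW; μ] R) (hs : MeasurableSet s) {h : Ω → ℝ}
    (hh : StronglyMeasurable[MeasurableSpace.comap (fun ω => (W ω, Z ω)) inferInstance] h)
    (hint : Integrable h μ) :
    ∫ ω, ind (R ⁻¹' s) ω * h ω ∂μ =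
      ∫ ω, condExp (MeasurableSpace.comap W inferInstance) μ (ind (R ⁻¹' s)) ω * h ω ∂μ := by
  have hhR : Integrable (fun ω => h ω * ind (R ⁻¹' s) ω) μ := by
    simpa only [mul_comm] using integrable_ind_mul (hR hs) hint
  simp_rw [mul_comm _ (h _)]
  rw [integral_mul_condExp (hW.prodMk hZ).comap_le hh hhR (integrable_ind (hR hs))]
  refine integral_congr_ae ?_
  filter_upwards [condExp_ind_preimage_of_condIndepFun hZ hR hW h_indep hs] with ω hω
  rw [hω]

end ConditionalIndependence

section Quantile

open Filter Topology

variable {ν : Measure ℝ} {p : ℝ}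

lemma nonempty_setOf_le_cdf (hp : p < 1) : {v | p ≤ cdf ν v}.Nonempty :=
  ((tendsto_cdf_atTop ν).eventually (eventually_ge_nhds hp)).exists

lemma bddBelow_setOf_le_cdf (hp : 0 < p) : BddBelow {v | p ≤ cdf ν v} := by
  obtain ⟨l, hl⟩ := ((tendsto_cdf_atBot ν).eventually (gt_mem_nhds hp)).exists
  exact ⟨l, fun v hv => ((monotone_cdf ν).reflect_lt (hl.trans_le hv)).le⟩

lemma cdf_quantile_eq (hp0 : 0 < p) (hp1 : p < 1) (hc : ContinuousAt (cdf ν) (quantile ν p)) :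
    cdf ν (quantile ν p) = p := by
  refine le_antisymm ?_ ?_
  · refine le_of_tendsto (hc.tendsto.mono_left (nhdsWithin_le_nhds (s := Iio (quantile ν p)))) ?_
    filter_upwards [self_mem_nhdsWithin] with u hu
    exact (not_le.1 fun h => (csInf_le (bddBelow_setOf_le_cdf hp0) h).not_gt hu).le
  · refine ge_of_tendsto (hc.tendsto.mono_left (nhdsWithin_le_nhds (s := Ioi (quantile ν p)))) ?_
    filter_upwards [self_mem_nhdsWithin] with u hu
    obtain ⟨w, hw, hwu⟩ :=
      (csInf_lt_iff (bddBelow_setOf_le_cdf hp0) (nonempty_setOf_le_cdf hp1)).1 hu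
    exact hw.trans (monotone_cdf ν hwu.le)

variable [IsProbabilityMeasure ν]

lemma measureReal_Iio_le_cdf (v : ℝ) : ν.real (Iio v) ≤ cdf ν v := by
  rw [cdf_eq_real]
  exact measureReal_mono Iio_subset_Iic_self

lemma cdf_le_measureReal_Iio {u v : ℝ} (huv : u < v) : cdf ν u ≤ ν.real (Iio v) := by
  rw [cdf_eq_real]
  exact measureReal_mono (Iic_subset_Iio.2 huv)

lemma quantile_eq_sInf_Iio (hp0 : 0 < p) (hp1 : p < 1) :
    quantile ν p = sInf {v | p ≤ ν.real (Iio v)} := by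
  have h_subset : {v | p ≤ ν.real (Iio v)} ⊆ {v | p ≤ cdf ν v} := fun v hv =>
    hv.trans (measureReal_Iio_le_cdf v)
  have h_shift {u v : ℝ} (hu : p ≤ cdf ν u) (huv : u < v) : p ≤ ν.real (Iio v) :=
    hu.trans (cdf_le_measureReal_Iio huv)
  obtain ⟨u, hu⟩ := nonempty_setOf_le_cdf (ν := ν) hp1
  refine le_antisymm
    (csInf_le_csInf (bddBelow_setOf_le_cdf hp0) ⟨u + 1, h_shift hu (lt_add_one u)⟩ h_subset)
    (le_csInf ⟨u, hu⟩ fun w hw => le_of_forall_gt_imp_ge_of_dense fun v hwv =>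
      csInf_le ((bddBelow_setOf_le_cdf hp0).mono h_subset) (h_shift hw hwv))

end Quantile

section Identification

/-- The event `R = 1` that the outcome is observed, as an event in the space of observed data. -/
abbrev responded (𝒳 : Type*) : Set (Obs 𝒳) := {o | Obs.r o = true}

lemma compl_setOf_eq_true {α : Type*} (R : α → Bool) : {a | R a = true}ᶜ = {a | R a = false} := by
  ext a
  simp

/-- The score `v` evaluated on the observed data. It is the true score only where `r = 1`. -/
abbrev obsScore {𝒳 : Type*} (v : 𝒳 → Bool → ℝ → ℝ) (o : Obs 𝒳) : ℝ :=
  v (Obs.x o) (Obs.d o) (Obs.y o)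

variable {Ω 𝒳 : Type*} [MeasurableSpace Ω] [MeasurableSpace 𝒳] {μ : Measure Ω}
  {X : Ω → 𝒳} {D R : Ω → Bool} {Y : Bool → Ω → ℝ} {v : 𝒳 → Bool → ℝ → ℝ}

/-- The `σ`-algebra `σ(X, D)` on the observed data. -/
abbrev covariates (𝒳 : Type*) [MeasurableSpace 𝒳] : MeasurableSpace (Obs 𝒳) :=
  MeasurableSpace.comap (fun o : Obs 𝒳 => (Obs.x o, Obs.d o)) inferInstance

/-- Positivity of the response mechanism: the outcome is observed with conditional probability
given `(X, D)` bounded away from zero, and it is missing with positive probability. -/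
structure ResponseOverlap (μ : Measure Ω) (X : Ω → 𝒳) (D R : Ω → Bool) : Prop where
  uniformPositivity : ∃ c, UniformPositivity
    (MeasurableSpace.comap (fun ω => (X ω, D ω)) inferInstance) μ {ω | R ω = true} c
  measure_ne_zero : μ {ω | R ω = false} ≠ 0

lemma Overlap.responseOverlap [IsProbabilityMeasure μ] (h : Overlap μ X D R) (hX : Measurable X)
    (hD : Measurable D) (hR : Measurable R) : ResponseOverlap μ X D R := by
  obtain ⟨c, hc, h⟩ := h
  have hR_true : MeasurableSet {ω | R ω = true} := hR (measurableSet_singleton true)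
  refine ⟨⟨c, hc, h.mono fun ω hω => hω.2.1.le⟩, fun h_zero => ?_⟩
  have h_true : μ.real {ω | R ω = true} = 1 := by
    rw [measureReal_def, (prob_compl_eq_zero_iff hR_true).1 (compl_setOf_eq_true R ▸ h_zero),
      ENNReal.toReal_one]
  have h_le : ∫ ω, responseProb μ X D R true ω ∂μ ≤ ∫ _, (1 - c) ∂μ :=
    integral_mono_ae integrable_condExp (integrable_const _) (h.mono fun ω hω => hω.2.2.le)
  rw [responseProb, integral_condExp (hX.prodMk hD).comap_le, integral_ind hR_true, h_true,
    integral_const, probReal_univ, one_smul] at h_le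
  linarith

lemma covariates_le : covariates 𝒳 ≤ (inferInstance : MeasurableSpace (Obs 𝒳)) :=
  (measurable_fst.prodMk measurable_snd.fst).comap_le

lemma measurableSet_responded : MeasurableSet (responded 𝒳) :=
  measurable_snd.snd.fst (measurableSet_singleton true)

lemma measurable_observedOutcome (hD : Measurable D) (hY : ∀ d, Measurable (Y d)) :
    Measurable fun ω => Y (D ω) ω :=
  (measurable_from_prod_countable_right (f := fun q : Bool × Ω => Y q.1 q.2) hY).comp
    (hD.prodMk measurable_id)

lemma measurable_observe (hX : Measurable X) (hD : Measurable D) (hR : Measurable R)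
    (hY : ∀ d, Measurable (Y d)) : Measurable (observe X D R Y) :=
  hX.prodMk (hD.prodMk (hR.prodMk (Measurable.ite (hR (measurableSet_singleton true))
    (measurable_observedOutcome hD hY) measurable_const)))

lemma measurable_obsScore (hv : Measurable fun q : 𝒳 × Bool × ℝ => v q.1 q.2.1 q.2.2) :
    Measurable (obsScore v) :=
  hv.comp (measurable_fst.prodMk (measurable_snd.fst.prodMk measurable_snd.snd.snd))

lemma measurable_score (hX : Measurable X) (hD : Measurable D) (hY : ∀ d, Measurable (Y d))
    (hv : Measurable fun q : 𝒳 × Bool × ℝ => v q.1 q.2.1 q.2.2) :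
    Measurable fun ω => v (X ω) (D ω) (Y (D ω) ω) :=
  hv.comp (hX.prodMk (hD.prodMk (measurable_observedOutcome hD hY)))

omit [MeasurableSpace Ω] in
lemma measurableSet_comap_score_lt (hv : Measurable fun q : 𝒳 × Bool × ℝ => v q.1 q.2.1 q.2.2)
    (η : ℝ) :
    MeasurableSet[MeasurableSpace.comap (fun ω => ((X ω, D ω), (Y true ω, Y false ω)))
      inferInstance] {ω | v (X ω) (D ω) (Y (D ω) ω) < η} := by
  let mΩ := MeasurableSpace.comap (fun ω => ((X ω, D ω), (Y true ω, Y false ω))) inferInstance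
  have h : Measurable[mΩ] fun ω => ((X ω, D ω), (Y true ω, Y false ω)) := comap_measurable _
  have hY : ∀ d, Measurable[mΩ] (Y d) := Bool.forall_bool.2 ⟨h.snd.snd, h.snd.fst⟩
  exact measurableSet_lt (measurable_score h.fst.fst h.fst.snd hY hv) measurable_const

lemma map_observe_compl_responded (hX : Measurable X) (hD : Measurable D) (hR : Measurable R)
    (hY : ∀ d, Measurable (Y d)) :
    μ.map (observe X D R Y) (responded 𝒳)ᶜ = μ {ω | R ω = false} := by
  rw [Measure.map_apply (measurable_observe hX hD hR hY) measurableSet_responded.compl,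
    compl_setOf_eq_true]
  rfl

variable [IsFiniteMeasure μ]

lemma isProbabilityMeasure_attritionLaw (hX : Measurable X) (hD : Measurable D)
    (hY : ∀ d, Measurable (Y d)) (hv : Measurable fun q : 𝒳 × Bool × ℝ => v q.1 q.2.1 q.2.2)
    (h : ResponseOverlap μ X D R) : IsProbabilityMeasure (attritionLaw μ X D R Y v) :=
  have := cond_isProbabilityMeasure h.measure_ne_zero
  Measure.isProbabilityMeasure_map (measurable_score hX hD hY hv).aemeasurable

lemma responseProb_observe (hX : Measurable X) (hD : Measurable D) (hR : Measurable R)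
    (hY : ∀ d, Measurable (Y d)) (b : Bool) :
    responseProb (μ.map (observe X D R Y)) Obs.x Obs.d Obs.r b ∘ observe X D R Y =ᵐ[μ]
      responseProb μ X D R b := by
  have h := condExp_map_comp (μ := μ) covariates_le (measurable_observe hX hD hR hY)
    (integrable_ind (measurable_snd.snd.fst (measurableSet_singleton b)))
  rwa [covariates, MeasurableSpace.comap_comp] at h

lemma condOdds_observe (hX : Measurable X) (hD : Measurable D) (hR : Measurable R)
    (hY : ∀ d, Measurable (Y d)) :
    condOdds (covariates 𝒳) (μ.map (observe X D R Y)) (responded 𝒳) ∘ observe X D R Y =ᵐ[μ]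
      condOdds (MeasurableSpace.comap (fun ω => (X ω, D ω)) inferInstance) μ {ω | R ω = true} := by
  filter_upwards [responseProb_observe (μ := μ) hX hD hR hY false,
    responseProb_observe (μ := μ) hX hD hR hY true] with ω h_false h_true
  rw [Function.comp_apply, condOdds, condOdds, compl_setOf_eq_true, compl_setOf_eq_true]
  exact congrArg₂ (· / ·) h_false h_true

lemma ResponseOverlap.uniformPositivity_observe (h : ResponseOverlap μ X D R) (hX : Measurable X)
    (hD : Measurable D) (hR : Measurable R) (hY : ∀ d, Measurable (Y d)) :
    ∃ c, UniformPositivity (covariates 𝒳) (μ.map (observe X D R Y)) (responded 𝒳) c := by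
  obtain ⟨c, hc, h_le⟩ := h.uniformPositivity
  refine ⟨c, hc, (ae_map_iff (measurable_observe hX hD hR hY).aemeasurable (measurableSet_le
    measurable_const (stronglyMeasurable_condExp.mono covariates_le).measurable)).2 ?_⟩
  filter_upwards [h_le, responseProb_observe (μ := μ) hX hD hR hY true] with ω hω h_eq
  exact hω.trans_eq h_eq.symm

section MissingAtRandom

variable [StandardBorelSpace Ω]

lemma MissingAtRandom.integral_ind_mul {hX : Measurable X} {hD : Measurable D}
    (h_mar : MissingAtRandom μ hX hD R Y) (hR : Measurable R) (hY : ∀ d, Measurable (Y d))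
    (b : Bool) {h : Ω → ℝ} (hh : StronglyMeasurable[MeasurableSpace.comap
      (fun ω => ((X ω, D ω), (Y true ω, Y false ω))) inferInstance] h)
    (hint : Integrable h μ) :
    ∫ ω, ind {ω | R ω = b} ω * h ω ∂μ = ∫ ω, responseProb μ X D R b ω * h ω ∂μ :=
  integral_ind_preimage_mul_of_condIndepFun ((hY true).prodMk (hY false)) hR (hX.prodMk hD) h_mar
    (measurableSet_singleton b) hh hint

lemma MissingAtRandom.integral_ind_condOdds_mul {hX : Measurable X} {hD : Measurable D}
    (h_mar : MissingAtRandom μ hX hD R Y) (hR : Measurable R) (hY : ∀ d, Measurable (Y d))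
    {c : ℝ} (H : UniformPositivity (MeasurableSpace.comap (fun ω => (X ω, D ω)) inferInstance) μ
      {ω | R ω = true} c) {h : Ω → ℝ} (hh : StronglyMeasurable[MeasurableSpace.comap
      (fun ω => ((X ω, D ω), (Y true ω, Y false ω))) inferInstance] h)
    (hint : Integrable h μ) :
    ∫ ω, ind {ω | R ω = true} ω * (condOdds (MeasurableSpace.comap (fun ω => (X ω, D ω))
        inferInstance) μ {ω | R ω = true} ω * h ω) ∂μ =
      ∫ ω, ind {ω | R ω = false} ω * h ω ∂μ := by
  have hXD : Measurable fun ω => (X ω, D ω) := hX.prodMk hD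
  have h_odds := memLp_top_condOdds hXD.comap_le H (hR (measurableSet_singleton true))
  have h_sub : MeasurableSpace.comap (fun ω => (X ω, D ω)) inferInstance ≤
      MeasurableSpace.comap (fun ω => ((X ω, D ω), (Y true ω, Y false ω))) inferInstance :=
    ((comap_measurable fun ω => ((X ω, D ω), (Y true ω, Y false ω))).fst).comap_le
  have h_true := h_mar.integral_ind_mul hR hY true
    ((stronglyMeasurable_condOdds.mono h_sub).mul hh) (hint.mul_of_top_right h_odds)
  simp_rw [Pi.mul_apply] at h_true
  rw [h_true, h_mar.integral_ind_mul hR hY false hh hint]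
  refine integral_congr_ae ?_
  filter_upwards [H.le_condExp] with ω hω
  have h_ne : responseProb μ X D R true ω ≠ 0 := (H.pos.trans_le hω).ne'
  rw [condOdds, compl_setOf_eq_true, ← mul_assoc]
  exact congrArg (· * h ω) (mul_div_cancel₀ _ h_ne)

lemma integral_ind_compl_mul_mC (hX : Measurable X) (hD : Measurable D) (hR : Measurable R)
    (hY : ∀ d, Measurable (Y d)) (hv : Measurable fun q : 𝒳 × Bool × ℝ => v q.1 q.2.1 q.2.2)
    (h : ResponseOverlap μ X D R) (h_mar : MissingAtRandom μ hX hD R Y) (η : ℝ) :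
    ∫ o, ind (responded 𝒳)ᶜ o * mC v (μ.map (observe X D R Y)) η o ∂(μ.map (observe X D R Y)) =
      ∫ ω, ind {ω | R ω = false} ω * ind {ω | v (X ω) (D ω) (Y (D ω) ω) < η} ω ∂μ := by
  have hT := measurable_observe hX hD hR hY
  have hS : MeasurableSet {o | obsScore v o < η} :=
    measurableSet_lt (measurable_obsScore hv) measurable_const
  obtain ⟨c, H⟩ := h.uniformPositivity
  obtain ⟨c', H'⟩ := h.uniformPositivity_observe hX hD hR hY
  calc ∫ o, ind (responded 𝒳)ᶜ o * mC v (μ.map (observe X D R Y)) η o ∂(μ.map (observe X D R Y))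
      = ∫ o, ind (responded 𝒳) o * (condOdds (covariates 𝒳) (μ.map (observe X D R Y))
          (responded 𝒳) o * ind {o | obsScore v o < η} o) ∂(μ.map (observe X D R Y)) :=
        integral_ind_compl_mul_condProbOn covariates_le H' measurableSet_responded hS
    _ = ∫ ω, ind {ω | R ω = true} ω * (condOdds (MeasurableSpace.comap (fun ω => (X ω, D ω))
          inferInstance) μ {ω | R ω = true} ω * ind {ω | v (X ω) (D ω) (Y (D ω) ω) < η} ω) ∂μ := by
        rw [integral_map hT.aemeasurable]
        · refine integral_congr_ae ?_
          filter_upwards [condOdds_observe (μ := μ) hX hD hR hY] with ω hω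
          rw [Function.comp_apply] at hω
          rw [hω]
          by_cases hRω : R ω = true <;>
            simp [indicator, obsScore, observe, Obs.r, Obs.x, Obs.d, Obs.y, hRω]
        · exact ((memLp_ind ∞ measurableSet_responded).1.mul
            ((memLp_top_condOdds covariates_le H' measurableSet_responded).1.mul
              (memLp_ind ∞ hS).1))
    _ = ∫ ω, ind {ω | R ω = false} ω * ind {ω | v (X ω) (D ω) (Y (D ω) ω) < η} ω ∂μ :=
        h_mar.integral_ind_condOdds_mul hR hY H
          (stronglyMeasurable_const.indicator (measurableSet_comap_score_lt hv η))
          (integrable_ind (measurableSet_lt (measurable_score hX hD hY hv) measurable_const))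

lemma integral_mC_eq_attritionLaw (hX : Measurable X) (hD : Measurable D) (hR : Measurable R)
    (hY : ∀ d, Measurable (Y d)) (hv : Measurable fun q : 𝒳 × Bool × ℝ => v q.1 q.2.1 q.2.2)
    (h : ResponseOverlap μ X D R) (h_mar : MissingAtRandom μ hX hD R Y) (η : ℝ) :
    ∫ o, mC v (μ.map (observe X D R Y)) η o ∂(cond (μ.map (observe X D R Y)) (responded 𝒳)ᶜ) =
      (attritionLaw μ X D R Y v).real (Iio η) := by
  have hV := measurable_score hX hD hY hv
  have h_ne : μ.real {ω | R ω = false} ≠ 0 := (measureReal_ne_zero_iff).2 h.measure_ne_zero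
  refine mul_left_cancel₀ h_ne ?_
  have h_obs := integral_ind_mul measurableSet_responded.compl (Q := μ.map (observe X D R Y))
    (mC v (μ.map (observe X D R Y)) η)
  have h_full := integral_ind_mul (hR (measurableSet_singleton false)) (Q := μ)
    (ind {ω | v (X ω) (D ω) (Y (D ω) ω) < η})
  rw [measureReal_def, map_observe_compl_responded hX hD hR hY, ← measureReal_def] at h_obs
  rw [integral_ind (measurableSet_lt hV measurable_const)] at h_full
  rw [← h_obs, integral_ind_compl_mul_mC hX hD hR hY hv h h_mar, attritionLaw,
    map_measureReal_apply hV measurableSet_Iio]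
  exact h_full

theorem quantile_attritionLaw_eq_etaC (hX : Measurable X) (hD : Measurable D)
    (hR : Measurable R) (hY : ∀ d, Measurable (Y d))
    (hv : Measurable fun q : 𝒳 × Bool × ℝ => v q.1 q.2.1 q.2.2) (h : ResponseOverlap μ X D R)
    (h_mar : MissingAtRandom μ hX hD R Y) {p : ℝ} (hp0 : 0 < p) (hp1 : p < 1) :
    quantile (attritionLaw μ X D R Y v) p = etaC v p (μ.map (observe X D R Y)) := by
  have := isProbabilityMeasure_attritionLaw hX hD hY hv h
  simp_rw [quantile_eq_sInf_Iio hp0 hp1, etaC, ← compl_setOf_eq_true,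
    integral_mC_eq_attritionLaw hX hD hR hY hv h h_mar]

end MissingAtRandom

end Identification

section EfficientInfluenceFunction

variable {𝒳 : Type*} [MeasurableSpace 𝒳] {v : 𝒳 → Bool → ℝ → ℝ}

lemma measurable_intervalScore {lo hi : Bool → 𝒳 → ℝ} (hlo : ∀ d, Measurable (lo d))
    (hhi : ∀ d, Measurable (hi d)) {V : 𝒳 × (ℝ × ℝ) → ℝ} (hV : Measurable V) :
    Measurable fun q : 𝒳 × Bool × ℝ => intervalScore V lo hi q.1 q.2.1 q.2.2 := by
  have hx : Measurable fun q : 𝒳 × Bool × ℝ => q.1 := measurable_fst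
  have hd : Measurable fun q : 𝒳 × Bool × ℝ => q.2.1 := measurable_snd.fst
  have hy : Measurable fun q : 𝒳 × Bool × ℝ => q.2.2 := measurable_snd.snd
  exact hV.comp (hx.prodMk (Measurable.ite (hd (measurableSet_singleton true))
    ((hy.sub ((hhi false).comp hx)).prodMk (hy.sub ((hlo false).comp hx)))
    ((((hlo true).comp hx).sub hy).prodMk (((hhi true).comp hx).sub hy))))

lemma etaC_eq_attritionQuantile (p : ℝ) :
    etaC v p = fun P => attritionQuantile (covariates 𝒳) P (responded 𝒳) (obsScore v) p := by
  simp_rw [attritionQuantile, compl_setOf_eq_true]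
  rfl

lemma psiC_eq_momentGradient (P : Measure (Obs 𝒳)) (γ η : ℝ) :
    psiC v P γ η =
      momentGradient (covariates 𝒳) P (responded 𝒳) {o | obsScore v o < η} (1 - γ) := by
  have h_odds (o : Obs 𝒳) : 1 / piR P o = condOdds (covariates 𝒳) P (responded 𝒳) o := by
    rw [condOdds, compl_setOf_eq_true]
    exact one_div_div _ _
  ext o
  by_cases hr : Obs.r o = true <;>
    simp [psiC, momentGradient, h_odds, hr, indicator, mC, condProbOn]

theorem isEfficientInfluenceFunction_psiC
    (hv : Measurable fun q : 𝒳 × Bool × ℝ => v q.1 q.2.1 q.2.2) {P : Measure (Obs 𝒳)}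
    [IsProbabilityMeasure P] {c : ℝ} (H : UniformPositivity (covariates 𝒳) P (responded 𝒳) c)
    (hAc : P (responded 𝒳)ᶜ ≠ 0) {γ η f : ℝ} (hf : 0 < f)
    (h_deriv : HasDerivAt (fun u => ∫ o, mC v P u o ∂(cond P (responded 𝒳)ᶜ)) f η)
    (h_val : ∫ o, mC v P η o ∂(cond P (responded 𝒳)ᶜ) = 1 - γ) :
    IsEfficientInfluenceFunction (etaC v (1 - γ)) P
      (fun o => -1 / (P.real (responded 𝒳)ᶜ * f) * psiC v P γ η o) := by
  rw [psiC_eq_momentGradient, etaC_eq_attritionQuantile]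
  exact isEfficientInfluenceFunction_attritionQuantile covariates_le H measurableSet_responded
    (measurable_obsScore hv) hAc hf h_deriv h_val

end EfficientInfluenceFunction

end Attrition

end

theorem theorem2_general {Ω 𝒳 : Type*} [MeasurableSpace Ω] [StandardBorelSpace Ω]
    [MeasurableSpace 𝒳] (μ : Measure Ω) [IsProbabilityMeasure μ]
    (X : Ω → 𝒳) (D R : Ω → Bool) (Y : Bool → Ω → ℝ)
    (hX : Measurable X) (hD : Measurable D) (hR : Measurable R) (hY : ∀ d, Measurable (Y d))
    (v : 𝒳 → Bool → ℝ → ℝ) (hv : Measurable fun q : 𝒳 × Bool × ℝ => v q.1 q.2.1 q.2.2)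
    (γ : ℝ) (hγ₀ : 0 < γ) (hγ₁ : γ < 1)
    (hMAR : Attrition.MissingAtRandom μ hX hD R Y)
    (hoverlap : Attrition.ResponseOverlap μ X D R)
    (η : ℝ) (hη : η = Attrition.quantile (Attrition.attritionLaw μ X D R Y v) (1 - γ))
    (f : ℝ) (hf : 0 < f)
    (hdensity : HasDerivAt (cdf (Attrition.attritionLaw μ X D R Y v)) f η) :
    (∀ (ν : Measure Ω) [IsProbabilityMeasure ν],
      Attrition.MissingAtRandom ν hX hD R Y → Attrition.ResponseOverlap ν X D R →
      Attrition.quantile (Attrition.attritionLaw ν X D R Y v) (1 - γ) =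
        Attrition.etaC v (1 - γ) (ν.map (Attrition.observe X D R Y))) ∧
    ∃ c : ℝ, c ≠ 0 ∧
      Attrition.IsEfficientInfluenceFunction (Attrition.etaC v (1 - γ))
        (μ.map (Attrition.observe X D R Y))
        (fun o => c * Attrition.psiC v (μ.map (Attrition.observe X D R Y)) γ η o) := by
  have hp0 : 0 < 1 - γ := sub_pos.2 hγ₁
  have hp1 : 1 - γ < 1 := sub_lt_self 1 hγ₀
  refine ⟨fun ν _ h_mar h =>
    Attrition.quantile_attritionLaw_eq_etaC hX hD hR hY hv h h_mar hp0 hp1, ?_⟩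
  have h_prob := Attrition.isProbabilityMeasure_attritionLaw hX hD hY hv hoverlap
  have h_le := Attrition.measureReal_Iio_le_cdf (ν := Attrition.attritionLaw μ X D R Y v)
  have h_ge (u w : ℝ) (h : u < w) :=
    Attrition.cdf_le_measureReal_Iio (ν := Attrition.attritionLaw μ X D R Y v) h
  have h_val := Attrition.apply_eq_of_squeeze hdensity.continuousAt h_le h_ge
  have h_deriv := Attrition.hasDerivAt_of_squeeze hdensity h_le h_ge
  have h_cdf : cdf (Attrition.attritionLaw μ X D R Y v) η = 1 - γ :=
    hη ▸ Attrition.cdf_quantile_eq hp0 hp1 (hη ▸ hdensity.continuousAt)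
  simp_rw [← Attrition.integral_mC_eq_attritionLaw hX hD hR hY hv hoverlap hMAR] at h_val h_deriv
  obtain ⟨c, H⟩ := hoverlap.uniformPositivity_observe hX hD hR hY
  have hAc : μ.map (Attrition.observe X D R Y) (Attrition.responded 𝒳)ᶜ ≠ 0 :=
    Attrition.map_observe_compl_responded hX hD hR hY ▸ hoverlap.measure_ne_zero
  have h_map : IsProbabilityMeasure (μ.map (Attrition.observe X D R Y)) :=
    Measure.isProbabilityMeasure_map (Attrition.measurable_observe hX hD hR hY).aemeasurable
  exact ⟨_, div_ne_zero (neg_ne_zero.2 one_ne_zero)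
      (mul_pos (ENNReal.toReal_pos hAc (measure_ne_top _ _)) hf).ne',
    Attrition.isEfficientInfluenceFunction_psiC hv H hAc hf h_deriv (h_val.trans h_cdf)⟩

theorem theorem2 {Ω 𝒳 : Type*} [MeasurableSpace Ω] [StandardBorelSpace Ω] [MeasurableSpace 𝒳]
    (μ : Measure Ω) [IsProbabilityMeasure μ]
    (X : Ω → 𝒳) (D R : Ω → Bool) (Y : Bool → Ω → ℝ)
    (hX : Measurable X) (hD : Measurable D) (hR : Measurable R) (hY : ∀ d, Measurable (Y d))
    (lo hi : Bool → 𝒳 → ℝ) (hlo : ∀ d, Measurable (lo d)) (hhi : ∀ d, Measurable (hi d))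
    (V : 𝒳 × (ℝ × ℝ) → ℝ) (hV : Measurable V)
    (γ : ℝ) (hγ₀ : 0 < γ) (hγ₁ : γ < 1)
    (hMAR : Attrition.MissingAtRandom μ hX hD R Y)
    (hoverlap : Attrition.Overlap μ X D R)
    (hodds : Integrable (fun ω => Attrition.responseProb μ X D R false ω ^ 2 /
      Attrition.responseProb μ X D R true ω) μ)
    (η : ℝ)
    (hη : η = Attrition.quantile
      (Attrition.attritionLaw μ X D R Y (Attrition.intervalScore V lo hi)) (1 - γ))
    (f : ℝ) (hf : 0 < f)
    (hdensity : HasDerivAt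
      (cdf (Attrition.attritionLaw μ X D R Y (Attrition.intervalScore V lo hi))) f η) :
    -- on every law of the model the target quantile is the functional `etaC` of the observed law
    (∀ (ν : Measure Ω) [IsProbabilityMeasure ν],
      Attrition.MissingAtRandom ν hX hD R Y → Attrition.Overlap ν X D R →
      Attrition.quantile
          (Attrition.attritionLaw ν X D R Y (Attrition.intervalScore V lo hi)) (1 - γ) =
        Attrition.etaC (Attrition.intervalScore V lo hi) (1 - γ)
          (ν.map (Attrition.observe X D R Y))) ∧
    -- and its efficient influence function is `ψ_C` up to a constant
    ∃ c : ℝ, c ≠ 0 ∧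
      Attrition.IsEfficientInfluenceFunction
        (Attrition.etaC (Attrition.intervalScore V lo hi) (1 - γ))
        (μ.map (Attrition.observe X D R Y))
        (fun o => c * Attrition.psiC (Attrition.intervalScore V lo hi)
          (μ.map (Attrition.observe X D R Y)) γ η o) := by
  obtain ⟨h_ident, h_eif⟩ := theorem2_general μ X D R Y hX hD hR hY
    (Attrition.intervalScore V lo hi) (Attrition.measurable_intervalScore hlo hhi hV) γ hγ₀ hγ₁ hMAR
    (hoverlap.responseOverlap hX hD hR) η hη f hf hdensity
  exact ⟨fun ν _ h_mar h => h_ident ν h_mar (h.responseOverlap hX hD hR), h_eif⟩
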